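/- **Setting.** Let $d\ge 2$, $\gamma>1$. Let $\Omega_p,\Omega_c\subset\mathbb R^d$ be bounded polyhedral domains carrying conforming simplicial meshes $\mathcal T_p(0)$ and $\mathcal T_c(0)$ with the same connectivity, $N\ge1$ elements, and vertices $x_i(0)$ and $\xi_i(0)$. Let $M$ be a symmetric matrix function, differentiable at the points of $\overline{\Omega_p}$, with $m_0I\le M(x)\le m_1I$ for $x\in\Omega_p$, where $m_0>0$. For vertex positions $x=(x_i)$, $\xi=(\xi_i)$ and an element $K$ let $E_K=[x_1^K-x_0^K,\dots,x_d^K-x_0^K]$, $\hat E_K=[\xi_1^K-\xi_0^K,\dots,\xi_d^K-\xi_0^K]$, $J_K=E_K\hat E_K^{-1}$, $|K|=|\det E_K|/d!$, $M_K=\frac1{d+1}\sum_{j=0}^dM(x^K_j)$, $A_K=J_K^{-1}M_K^{-1}J_K^{-T}$, and $$I_h(x,\xi)=\sum_K|K|\,G(A_K,\det A_K,M_K),\qquad G(A,a,M)=\sqrt{\det M}\Big(\operatorname{tr}(A)^{\frac{d\gamma}2}-d^{\frac{d\gamma}2}\tfrac\gamma2\,\theta^{\frac{d\gamma}2}\ln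 a\Big),$$ where $\theta=(\sigma/|\Omega_c|)^{-2/d}$ and $\sigma=\int_{\Omega_p}\sqrt{\det M(x)}\,dx$. The mesh is called nonsingular if $\det J_K>0$ for every $K$; the initial mesh is assumed nonsingular. Let $\tau>0$, let $P_i(t)>0$ be arbitrary (they may depend on the mesh), let $0<T\le\infty$, and let $W_i\subseteq\mathbb R^d$ be a linear subspace of admissible velocities for the vertex $i$, with orthogonal projection $\Pi_i$ ($W_i=\mathbb R^d$ for a free vertex, $W_i=\{0\}$ for a fixed one). Consider a continuous trajectory on $[0,T)$ starting from the initial mesh, of one of the following two kinds; the equation is required for $0<t<T$ as long as the mesh is nonsingular. * *Physical flow*: $\xi$ is constant, $\frac{dx_i}{dt}=-\frac{P_i}{\tau}\Pi_i\frac{\partial I_h}{\partial x_i}$, all $x_i(t)$ stay in $\overline{\Omega_p}$ (where $M$ is given), and boundary vertices are fixed or slide along the boundary: $W_i$ is contained in the direction space of every facet of $\mathcal T_p(0)$ that contains the vertex $i$ and belongs to only one element. * *Computational flow*: $x$ is constant and $\frac{d\xi_i}{dt}=-\frac{P_i}{\tau}\Pi_i\frac{\partial I_h}{\partial \xi_i}$,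 with arbitrary $W_i$ (for example $W_i=\mathbb R^d$ for all $i$). **Assertion.** There are constants $\alpha>0$, $\beta\ge0$ (coercivity constants) such that, with $A=J^{-1}M^{-1}J^{-T}$, $$G(A,\det A,M)\ge\alpha\operatorname{tr}(A)^{\frac{d\gamma}2}-\beta\qquad\text{for all }J\text{ with }\det J>0\text{ and all symmetric }M\text{ with }m_0I\le M\le m_1I .$$ For any such $\alpha,\beta$, and for either kind of trajectory, the following holds. For all $t\in[0,T)$ the mesh is nonsingular, so all physical and all computational elements have positive volume. Moreover, if $r_0>0$ and $r_0N^{-1/d}\le r_{K_c}$ for all elements $K_c$ of the computational mesh at time $t$, where $r_{K_c}$ is the diameter of the largest ball inscribed in $K_c$, then for every element $K$ of the physical mesh at time $t$ $$a_{K,M}\ \ge\ C_1\,r_0^{\frac{\gamma}{\gamma-1}}\,m_1^{-\frac1{2(\gamma-1)}}\,N^{-\frac{\gamma}{d\gamma-d}},\qquad |K|\ \ge\ C_2\,r_0^{\frac{d\gamma}{\gamma-1}}\,m_1^{-\frac d{2(\gamma-1)}-\frac d2}\,N^{-\frac\gamma{\gamma-1}} .$$ Here $a_{K,M}$ is the minimum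 height of $K$ measured in the metric $M_K$, and $$C_1=\left(\frac{\alpha\,\hat a^{d\gamma}}{d!\,\hat h^{d\gamma}\,\big(\beta|\Omega_p|+I_h(x(0),\xi(0))\big)}\right)^{\frac1{d\gamma-d}},\qquad C_2=\frac{C_1^d}{d!},$$ where $\hat a$ and $\hat h$ are the minimum height and the diameter of a fixed nondegenerate reference simplex $\hat K$ in $\mathbb R^d$ (the bounds hold for every choice of $\hat K$). -/

import Mathlib

open MeasureTheory Matrix

namespace MovingMesh

/-- Euclidean space `ℝ^d`. -/
abbrev Space (d : ℕ) : Type := EuclideanSpace ℝ (Fin d)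

section Simplices

variable {d : ℕ}

/-- The closed simplex with the vertices `p 0, …, p d`. -/
def simplex (p : Fin (d + 1) → Space d) : Set (Space d) :=
  convexHull ℝ (Set.range p)

/-- The edge matrix `[p 1 - p 0, …, p d - p 0]` of a simplex (the edges are its columns). -/
def edgeMatrix (p : Fin (d + 1) → Space d) : Matrix (Fin d) (Fin d) ℝ :=
  Matrix.of fun a j => (p j.succ - p 0) a

/-- The volume `|det E| / d!` of the simplex with edge matrix `E`. -/
noncomputable def simplexVolume (p : Fin (d + 1) → Space d) : ℝ :=
  |(edgeMatrix p).det| / (d.factorial : ℝ)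

/-- The length `√(vᵀ M v)` of the vector `v` in the metric `M`. -/
noncomputable def metricLength (M : Matrix (Fin d) (Fin d) ℝ) (v : Space d) : ℝ :=
  Real.sqrt (v.ofLp ⬝ᵥ (M *ᵥ v.ofLp))

/-- The height of a simplex over the facet opposite to the vertex `j`, measured in the metric `M`:
the distance from `p j` to the affine span of the other vertices. -/
noncomputable def height (M : Matrix (Fin d) (Fin d) ℝ) (p : Fin (d + 1) → Space d)
    (j : Fin (d + 1)) : ℝ :=
  ⨅ y : affineSpan ℝ (p '' {j}ᶜ), metricLength M (p j - (y : Space d))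

/-- The minimum height of a simplex measured in the metric `M`. -/
noncomputable def minHeight (M : Matrix (Fin d) (Fin d) ℝ) (p : Fin (d + 1) → Space d) : ℝ :=
  ⨅ j : Fin (d + 1), height M p j

/-- The diameter of the largest ball inscribed in a simplex. -/
noncomputable def inDiameter (p : Fin (d + 1) → Space d) : ℝ :=
  sSup {s : ℝ | 0 ≤ s ∧ ∃ c : Space d, Metric.closedBall c (s / 2) ⊆ simplex p}

end Simplices

section Meshes

variable {d : ℕ} {V Elt : Type*}

/-- The vertices of the element `K` when the mesh vertices are placed at `x`;
`conn K` lists the labels of the vertices of `K`. -/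
def elementVertices (conn : Elt → Fin (d + 1) → V) (x : V → Space d) (K : Elt) :
    Fin (d + 1) → Space d :=
  fun j => x (conn K j)

/-- With its vertices placed at `x`, the connectivity `conn` is a conforming simplicial mesh of
the domain `Ω`: the elements are nondegenerate simplices, they fill the closure of `Ω`, their
interiors lie in `Ω`, and two distinct elements meet exactly in the face spanned by their common
vertices. -/
structure IsMeshOf (conn : Elt → Fin (d + 1) → V) (x : V → Space d) (Ω : Set (Space d)) :
    Prop where
  nondegenerate : ∀ K, AffineIndependent ℝ (elementVertices conn x K)
  union_eq : (⋃ K, simplex (elementVertices conn x K)) = closure Ω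
  interior_subset : ∀ K, interior (simplex (elementVertices conn x K)) ⊆ Ω
  distinct : ∀ K K', K ≠ K' → Set.range (conn K) ≠ Set.range (conn K')
  conforming : ∀ K K', K ≠ K' →
    simplex (elementVertices conn x K) ∩ simplex (elementVertices conn x K') =
      convexHull ℝ (x '' (Set.range (conn K) ∩ Set.range (conn K')))

/-- The facet of the element `K` opposite to its vertex `j`, as a set of vertex labels. -/
def facet (conn : Elt → Fin (d + 1) → V) (K : Elt) (j : Fin (d + 1)) : Set V :=
  conn K '' {j}ᶜ

/-- A facet is a boundary facet if it belongs to one element only. -/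
def IsBoundaryFacet (conn : Elt → Fin (d + 1) → V) (K : Elt) (j : Fin (d + 1)) : Prop :=
  ∀ K', facet conn K j ⊆ Set.range (conn K') → K' = K

/-- The admissible velocity spaces `W i` of the vertices keep the boundary: a vertex of a
boundary facet may only move in directions parallel to that facet. (A vertex with `W i = ⊥` is
fixed. There is no condition at interior vertices, where usually `W i = ⊤`.) -/
def KeepsBoundary (conn : Elt → Fin (d + 1) → V) (x : V → Space d)
    (W : V → Submodule ℝ (Space d)) : Prop :=
  ∀ K j, IsBoundaryFacet conn K j → ∀ i ∈ facet conn K j,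
    W i ≤ (affineSpan ℝ (x '' facet conn K j)).direction

/-- The Jacobian matrix `J_K = E_K Ê_K⁻¹` of the affine map from the computational element to the
physical element `K`, for physical vertices `x` and computational vertices `ξ`. -/
noncomputable def jacobian (conn : Elt → Fin (d + 1) → V) (x ξ : V → Space d) (K : Elt) :
    Matrix (Fin d) (Fin d) ℝ :=
  edgeMatrix (elementVertices conn x K) * (edgeMatrix (elementVertices conn ξ K))⁻¹

/-- Nonsingular mesh: the element maps are well defined, invertible and keep the orientation. -/
def Nonsingular (conn : Elt → Fin (d + 1) → V) (x ξ : V → Space d) : Prop :=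
  ∀ K, 0 < (jacobian conn x ξ K).det

/-- The metric `M_K` on an element: the average of the values of `M` at its vertices. -/
noncomputable def elementMetric (M : Space d → Matrix (Fin d) (Fin d) ℝ)
    (conn : Elt → Fin (d + 1) → V) (x : V → Space d) (K : Elt) : Matrix (Fin d) (Fin d) ℝ :=
  ((d : ℝ) + 1)⁻¹ • ∑ j : Fin (d + 1), M (elementVertices conn x K j)

end Meshes

section Functional

variable {d : ℕ}

/-- `m₀ I ≤ M ≤ m₁ I` in the sense of symmetric matrices (so `M` is symmetric). -/
def MetricBounds (m₀ m₁ : ℝ) (M : Matrix (Fin d) (Fin d) ℝ) : Prop :=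
  (M - m₀ • (1 : Matrix (Fin d) (Fin d) ℝ)).PosSemidef ∧
    (m₁ • (1 : Matrix (Fin d) (Fin d) ℝ) - M).PosSemidef

/-- `A = J⁻¹ M⁻¹ J⁻ᵀ`. -/
noncomputable def pullback (J M : Matrix (Fin d) (Fin d) ℝ) : Matrix (Fin d) (Fin d) ℝ :=
  J⁻¹ * M⁻¹ * (J⁻¹)ᵀ

/-- The integrand
`G(A, α, M) = √(det M) (tr(A)^(dγ/2) - d^(dγ/2) (γ/2) θ^(dγ/2) ln α)`. -/
noncomputable def integrand (γ θ : ℝ) (A : Matrix (Fin d) (Fin d) ℝ) (α : ℝ)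
    (M : Matrix (Fin d) (Fin d) ℝ) : ℝ :=
  Real.sqrt M.det *
    (A.trace ^ ((d : ℝ) * γ / 2) -
      (d : ℝ) ^ ((d : ℝ) * γ / 2) * (γ / 2) * θ ^ ((d : ℝ) * γ / 2) * Real.log α)

/-- `θ = (σ / |Ω_c|)^(-2/d)` with `σ = ∫_{Ω_p} √(det M(x)) dx`. -/
noncomputable def theta (M : Space d → Matrix (Fin d) (Fin d) ℝ) (Ωp Ωc : Set (Space d)) : ℝ :=
  ((∫ x in Ωp, Real.sqrt (M x).det) / volume.real Ωc) ^ (-2 / (d : ℝ))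

/-- `α` and `β` are coercivity constants of the integrand:
`G ≥ α tr(A)^(dγ/2) - β` for all `J` with `det J > 0` and all `M` with `m₀ I ≤ M ≤ m₁ I`. -/
def IsCoercive (d : ℕ) (γ θ m₀ m₁ α β : ℝ) : Prop :=
  ∀ J M : Matrix (Fin d) (Fin d) ℝ, 0 < J.det → MetricBounds m₀ m₁ M →
    α * (pullback J M).trace ^ ((d : ℝ) * γ / 2) - β ≤
      integrand γ θ (pullback J M) (pullback J M).det M

/-- The discrete functional `I_h = ∑_K |K| G(A_K, det A_K, M_K)`. -/
noncomputable def discreteEnergy {V Elt : Type*} [Fintype Elt] (γ θ : ℝ)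
    (M : Space d → Matrix (Fin d) (Fin d) ℝ) (conn : Elt → Fin (d + 1) → V)
    (x ξ : V → Space d) : ℝ :=
  ∑ K, simplexVolume (elementVertices conn x K) *
    integrand γ θ (pullback (jacobian conn x ξ K) (elementMetric M conn x K))
      (pullback (jacobian conn x ξ K) (elementMetric M conn x K)).det (elementMetric M conn x K)

/-- `y` is a solution on `[0, T)`, `T ≤ ∞`, of the gradient flow
`dy_i/dt = -(P_i/τ) Π_i (∂I/∂y_i)`, where `Π_i` is the orthogonal projection onto the space `W i`
of admissible velocities of the vertex `i`. The equation is only required while the mesh is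
nonsingular, since `I` and its gradient have no meaning at a singular mesh. -/
structure IsGradientFlow {V : Type*} [DecidableEq V] (I : (V → Space d) → ℝ)
    (nonsingular : (V → Space d) → Prop) (W : V → Submodule ℝ (Space d)) (P : ℝ → V → ℝ)
    (τ : ℝ) (T : EReal) (y : ℝ → V → Space d) : Prop where
  continuousOn : ContinuousOn y {t : ℝ | 0 ≤ t ∧ (t : EReal) < T}
  equation : ∀ t : ℝ, 0 < t → (t : EReal) < T → nonsingular (y t) → ∀ i,
    HasDerivAt (fun s => y s i)
      (-(P t i / τ) •
        (W i).starProjection (gradient (fun z => I (Function.update (y t) i z)) (y t i))) t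

end Functional

section Bounds

/-- The constant `C₁ = (α â^(dγ) / (d! ĥ^(dγ) (β|Ω_p| + I_h(0))))^(1/(dγ-d))`. -/
noncomputable def constC₁ (d : ℕ) (γ α β aHat hHat volΩ energy₀ : ℝ) : ℝ :=
  (α * aHat ^ ((d : ℝ) * γ) /
    ((d.factorial : ℝ) * hHat ^ ((d : ℝ) * γ) * (β * volΩ + energy₀))) ^
      (1 / ((d : ℝ) * γ - d))

/-- The constant `C₂ = C₁^d / d!`. -/
noncomputable def constC₂ (d : ℕ) (γ α β aHat hHat volΩ energy₀ : ℝ) : ℝ :=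
  constC₁ d γ α β aHat hHat volΩ energy₀ ^ d / (d.factorial : ℝ)

/-- The lower bounds for the minimum height in the metric `M_K` and for the volume of every
element, in terms of `C₁`, `C₂`, `r₀`, `m₁` and the number of elements. -/
def LowerBounds {d : ℕ} {V Elt : Type*} [Fintype Elt] (γ : ℝ)
    (M : Space d → Matrix (Fin d) (Fin d) ℝ) (conn : Elt → Fin (d + 1) → V) (x : V → Space d)
    (C₁ C₂ r₀ m₁ : ℝ) : Prop :=
  ∀ K,
    C₁ * r₀ ^ (γ / (γ - 1)) * m₁ ^ (-(1 / (2 * (γ - 1)))) *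
        (Fintype.card Elt : ℝ) ^ (-(γ / ((d : ℝ) * γ - d))) ≤
      minHeight (elementMetric M conn x K) (elementVertices conn x K) ∧
    C₂ * r₀ ^ ((d : ℝ) * γ / (γ - 1)) * m₁ ^ (-((d : ℝ) / (2 * (γ - 1))) - (d : ℝ) / 2) *
        (Fintype.card Elt : ℝ) ^ (-(γ / (γ - 1))) ≤
      simplexVolume (elementVertices conn x K)

/-- The computational elements satisfy `r₀ N^(-1/d) ≤ r_{K_c}`, with `N` the number of elements
and `r_{K_c}` the diameter of the largest ball inscribed in `K_c`. -/
def InDiameterBound {d : ℕ} {V Elt : Type*} [Fintype Elt] (conn : Elt → Fin (d + 1) → V)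
    (ξ : V → Space d) (r₀ : ℝ) : Prop :=
  ∀ K, r₀ * (Fintype.card Elt : ℝ) ^ (-(1 / (d : ℝ))) ≤ inDiameter (elementVertices conn ξ K)

end Bounds

end MovingMesh

/-! Write `B = β|Ω_p| + I_h(0)`. Along either flow the velocity of each vertex is a negative
multiple of a projected gradient, so the energy cannot increase while the mesh is nonsingular
(`IsGradientFlow.energy_le`). Coercivity makes every summand of the energy nonnegative once `β|K|`
is added. If the total volume is at most `|Ω_p|`, each single element therefore satisfies `α |K|
tr(A_K)^(dγ/2) ≤ B` (`trace_rpow_le_energy`).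

Nonsingularity is a barrier argument (`pos_of_barrier`): as long as all determinants are positive,
they stay above a fixed positive constant, so by continuity none of them reaches zero. For the
physical flow, the arithmetic-geometric mean inequality gives `tr(A)^(dγ/2) ≥ det(A)^(γ/2)`, which
is of order `|K|^(-γ)`; since `γ > 1`, the bound on `|K| tr(A)^(dγ/2)` keeps `|K|` away from zero
(`det_rpow_le_of_trace_rpow_le`). For the computational flow the trace does not prevent collapse,
but `-ln det A` blows up, and a bounded integrand gives an exponential lower bound
(`exp_le_det_sq_of_integrand_le`); this uses `θ > 0`.

The volume bound needs an argument for moving physical vertices. At the initial mesh, the elements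
have disjoint interiors inside `Ω_p` (`IsMeshOf.sum_simplexVolume_le`). Afterwards, the oriented sum
of determinants is invariant under admissible displacements (`signedVolume_eq`): its variation is a
sum over facets that cancels between the two elements at an interior facet and vanishes at a
boundary facet. While orientations persist, this sum is `d!` times the total volume.

The quantitative bounds combine two geometric facts with the element estimate. The in-diameter of
the computational element is at most `√(tr A)` times the minimum height `a`
(`inDiameter_le_sqrt_trace_mul_minHeight`), and `a^d ≤ d! |K| √(det M)` (`minHeight_pow_le`).
Raising the first to the power `dγ` and using the second leaves a lower bound for `a^(dγ-d)`; this
is `element_bounds`. -/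

namespace MovingMesh

/-! ### Cauchy–Schwarz in a metric and the determinant–trace inequality -/

section LinearAlgebra

variable {n : Type*} [Fintype n]

/-- The quadratic form on the line `x + t y` is nonnegative, so its discriminant in `t` is not
positive. -/
theorem posSemidef_dotProduct_sq_le {M : Matrix n n ℝ} (hM : M.PosSemidef) (x y : n → ℝ) :
    (x ⬝ᵥ (M *ᵥ y)) ^ 2 ≤ (x ⬝ᵥ (M *ᵥ x)) * (y ⬝ᵥ (M *ᵥ y)) := by
  have hsymm : y ⬝ᵥ (M *ᵥ x) = x ⬝ᵥ (M *ᵥ y) := by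
    rw [dotProduct_mulVec, ← mulVec_transpose, dotProduct_comm]
    have : Mᵀ = M := by simpa using hM.1.eq
    rw [this]
  have h : ∀ t : ℝ, 0 ≤ (y ⬝ᵥ (M *ᵥ y)) * (t * t) + (2 * (x ⬝ᵥ (M *ᵥ y))) * t +
      x ⬝ᵥ (M *ᵥ x) := by
    intro t
    have := hM.dotProduct_mulVec_nonneg (x + t • y)
    simp only [star_trivial, mulVec_add, mulVec_smul, add_dotProduct, dotProduct_add,
      smul_dotProduct, dotProduct_smul, smul_eq_mul, hsymm] at this
    linarith
  have := discrim_le_zero h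
  unfold discrim at this
  linarith

variable [DecidableEq n]

theorem posDef_dotProduct_sq_le {M : Matrix n n ℝ} (hM : M.PosDef) (w u : n → ℝ) :
    (w ⬝ᵥ u) ^ 2 ≤ (w ⬝ᵥ (M⁻¹ *ᵥ w)) * (u ⬝ᵥ (M *ᵥ u)) := by
  have hdet : IsUnit M.det := hM.det_pos.ne'.isUnit
  have hw : M *ᵥ (M⁻¹ *ᵥ w) = w := by
    rw [mulVec_mulVec, mul_nonsing_inv _ hdet, one_mulVec]
  have := posSemidef_dotProduct_sq_le hM.posSemidef u (M⁻¹ *ᵥ w)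
  rw [hw] at this
  rw [dotProduct_comm w u, dotProduct_comm w (M⁻¹ *ᵥ w)]
  linarith

/-- Cauchy–Schwarz in the dual pair of metrics `M⁻¹`, `M`, applied to each row of `B`; summing the
factors that come from the rows produces the trace. -/
theorem mulVec_dotProduct_self_le {M : Matrix n n ℝ} (hM : M.PosDef) (B : Matrix n n ℝ)
    (u : n → ℝ) :
    (B *ᵥ u) ⬝ᵥ (B *ᵥ u) ≤ (B * M⁻¹ * Bᵀ).trace * (u ⬝ᵥ (M *ᵥ u)) := by
  rw [dotProduct, trace, Finset.sum_mul]
  refine Finset.sum_le_sum fun i _ => ?_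
  have h1 : (B *ᵥ u) i = B i ⬝ᵥ u := rfl
  have h2 : (B * M⁻¹ * Bᵀ).diag i = B i ⬝ᵥ (M⁻¹ *ᵥ B i) := by
    rw [diag_apply, Matrix.mul_assoc, mul_apply_eq_vecMul]
    rw [← mulVec_transpose, transpose_mul, transpose_transpose]
    rw [← mulVec_mulVec]
    simp only [mulVec, dotProduct]
    refine Finset.sum_congr rfl fun k _ => ?_
    congr 1
    refine Finset.sum_congr rfl fun l _ => ?_
    have : (M⁻¹)ᵀ = M⁻¹ := by simpa using hM.inv.isHermitian.eq
    rw [this]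
  rw [h1, h2, ← pow_two]
  exact posDef_dotProduct_sq_le hM _ _

/-- The inequality of arithmetic and geometric means for the eigenvalues. -/
theorem det_le_trace_div_pow [Nonempty n] {A : Matrix n n ℝ} (hA : A.PosSemidef) :
    A.det ≤ (A.trace / Fintype.card n) ^ Fintype.card n := by
  have hc : (0 : ℝ) < Fintype.card n := by exact_mod_cast Fintype.card_pos
  have hdet : A.det = ∏ i, hA.1.eigenvalues i := by
    simpa using hA.1.det_eq_prod_eigenvalues
  have htr : A.trace = ∑ i, hA.1.eigenvalues i := by
    simpa using hA.1.trace_eq_sum_eigenvalues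
  have h := Real.geom_mean_le_arith_mean Finset.univ (fun _ => (1 : ℝ)) hA.1.eigenvalues
    (fun _ _ => zero_le_one) (by simpa using hc) (fun i _ => hA.eigenvalues_nonneg i)
  simp only [Real.rpow_one, Finset.sum_const, Finset.card_univ, nsmul_eq_mul, mul_one,
    one_mul] at h
  rw [← hdet, ← htr] at h
  have h0 : 0 ≤ A.det := hA.det_nonneg
  calc A.det = (A.det ^ ((Fintype.card n : ℝ)⁻¹)) ^ Fintype.card n := by
        rw [← Real.rpow_natCast, ← Real.rpow_mul h0, inv_mul_cancel₀ hc.ne', Real.rpow_one]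
    _ ≤ _ := pow_le_pow_left₀ (Real.rpow_nonneg h0 _) h _

end LinearAlgebra

/-! ### Consequences of the spectral bounds on the metric -/

section Bounds

variable {d : ℕ}

theorem MetricBounds.mul_le {m₀ m₁ : ℝ} {M : Matrix (Fin d) (Fin d) ℝ}
    (h : MetricBounds m₀ m₁ M) (u : Fin d → ℝ) : m₀ * (u ⬝ᵥ u) ≤ u ⬝ᵥ (M *ᵥ u) := by
  have := h.1.dotProduct_mulVec_nonneg u
  simp only [star_trivial, sub_mulVec, smul_mulVec, one_mulVec, dotProduct_sub, dotProduct_smul,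
    smul_eq_mul] at this
  linarith

theorem MetricBounds.le_mul {m₀ m₁ : ℝ} {M : Matrix (Fin d) (Fin d) ℝ}
    (h : MetricBounds m₀ m₁ M) (u : Fin d → ℝ) : u ⬝ᵥ (M *ᵥ u) ≤ m₁ * (u ⬝ᵥ u) := by
  have := h.2.dotProduct_mulVec_nonneg u
  simp only [star_trivial, sub_mulVec, smul_mulVec, one_mulVec, dotProduct_sub, dotProduct_smul,
    smul_eq_mul] at this
  linarith

theorem MetricBounds.isHermitian {m₀ m₁ : ℝ} {M : Matrix (Fin d) (Fin d) ℝ}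
    (h : MetricBounds m₀ m₁ M) : M.IsHermitian := by
  have h1 : (m₀ • (1 : Matrix (Fin d) (Fin d) ℝ)).IsHermitian := by
    rw [IsHermitian, conjTranspose_smul, conjTranspose_one, star_trivial]
  have := h.1.1.add h1
  rwa [sub_add_cancel] at this

theorem metricBounds_iff {m₀ m₁ : ℝ} {M : Matrix (Fin d) (Fin d) ℝ} :
    MetricBounds m₀ m₁ M ↔ M.IsHermitian ∧
      ∀ u : Fin d → ℝ, m₀ * (u ⬝ᵥ u) ≤ u ⬝ᵥ (M *ᵥ u) ∧ u ⬝ᵥ (M *ᵥ u) ≤ m₁ * (u ⬝ᵥ u) := by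
  refine ⟨fun h => ⟨h.isHermitian, fun u => ⟨h.mul_le u, h.le_mul u⟩⟩, fun ⟨h, hu⟩ => ?_⟩
  have h1 : ∀ m : ℝ, (m • (1 : Matrix (Fin d) (Fin d) ℝ)).IsHermitian := fun m => by
    rw [IsHermitian, conjTranspose_smul, conjTranspose_one, star_trivial]
  constructor
  · refine PosSemidef.of_dotProduct_mulVec_nonneg (h.sub (h1 m₀)) fun u => ?_
    simp only [star_trivial, sub_mulVec, smul_mulVec, one_mulVec, dotProduct_sub,
      dotProduct_smul, smul_eq_mul]
    linarith [(hu u).1]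
  · refine PosSemidef.of_dotProduct_mulVec_nonneg ((h1 m₁).sub h) fun u => ?_
    simp only [star_trivial, sub_mulVec, smul_mulVec, one_mulVec, dotProduct_sub,
      dotProduct_smul, smul_eq_mul]
    linarith [(hu u).2]

theorem MetricBounds.posDef {m₀ m₁ : ℝ} (hm₀ : 0 < m₀) {M : Matrix (Fin d) (Fin d) ℝ}
    (h : MetricBounds m₀ m₁ M) : M.PosDef := by
  refine PosDef.of_dotProduct_mulVec_pos h.isHermitian fun u hu => ?_
  rw [star_trivial]
  refine lt_of_lt_of_le (mul_pos hm₀ ?_) (h.mul_le u)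
  have := Matrix.dotProduct_star_self_pos_iff.2 hu
  rwa [star_trivial] at this

theorem MetricBounds.le {m₀ m₁ : ℝ} (hd : 0 < d) {M : Matrix (Fin d) (Fin d) ℝ}
    (h : MetricBounds m₀ m₁ M) : m₀ ≤ m₁ := by
  have h1 := h.mul_le (Pi.single ⟨0, hd⟩ 1)
  have h2 := h.le_mul (Pi.single ⟨0, hd⟩ 1)
  have h3 : (Pi.single (⟨0, hd⟩ : Fin d) (1 : ℝ)) ⬝ᵥ (Pi.single (⟨0, hd⟩ : Fin d) (1 : ℝ)) = 1 := by
    simp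
  rw [h3] at h1 h2
  linarith

theorem MetricBounds.diag_le {m₀ m₁ : ℝ} {M : Matrix (Fin d) (Fin d) ℝ}
    (h : MetricBounds m₀ m₁ M) (i : Fin d) : M i i ≤ m₁ := by
  have h2 := h.le_mul (Pi.single i 1)
  simpa using h2

/-- For `z = M⁻¹ eᵢ` one has `z · M z = zᵢ`, hence `m₀ zᵢ² ≤ m₀ |z|² ≤ zᵢ`, and `zᵢ` is positive. -/
theorem MetricBounds.inv_diag_le {m₀ m₁ : ℝ} (hm₀ : 0 < m₀) {M : Matrix (Fin d) (Fin d) ℝ}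
    (h : MetricBounds m₀ m₁ M) (i : Fin d) : M⁻¹ i i ≤ m₀⁻¹ := by
  have hM := h.posDef hm₀
  set z := M⁻¹ *ᵥ Pi.single i 1 with hz
  have hzi : z i = M⁻¹ i i := by simp [hz]
  have h1 := h.mul_le z
  have h2 : M *ᵥ z = Pi.single i 1 := by
    rw [hz, mulVec_mulVec, mul_nonsing_inv _ hM.det_pos.ne'.isUnit, one_mulVec]
  rw [h2, dotProduct_single, mul_one, hzi] at h1
  have h3 : z i * z i ≤ z ⬝ᵥ z :=
    Finset.single_le_sum (f := fun k => z k * z k) (fun k _ => mul_self_nonneg _)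
      (Finset.mem_univ i)
  rw [hzi] at h3
  have hpos : 0 < M⁻¹ i i := hM.inv.diag_pos
  have h4 : m₀ * (M⁻¹ i i * M⁻¹ i i) ≤ M⁻¹ i i :=
    (mul_le_mul_of_nonneg_left h3 hm₀.le).trans h1
  rw [le_inv_comm₀ hpos hm₀, ← one_div, le_div_iff₀ hpos]
  nlinarith

theorem trace_div_pow_le {A : Matrix (Fin d) (Fin d) ℝ} (hA : A.PosSemidef) {m : ℝ}
    (h : ∀ i, A i i ≤ m) (hd : 0 < d) : A.det ≤ m ^ d := by
  have : Nonempty (Fin d) := ⟨⟨0, hd⟩⟩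
  refine (det_le_trace_div_pow hA).trans ?_
  rw [Fintype.card_fin]
  refine pow_le_pow_left₀ (div_nonneg hA.trace_nonneg (Nat.cast_nonneg _)) ?_ _
  rw [div_le_iff₀ (by exact_mod_cast hd)]
  refine (Finset.sum_le_card_nsmul _ _ m fun i _ => h i).trans ?_
  simp [mul_comm]

theorem MetricBounds.det_le {m₀ m₁ : ℝ} (hm₀ : 0 < m₀) (hd : 0 < d)
    {M : Matrix (Fin d) (Fin d) ℝ} (h : MetricBounds m₀ m₁ M) : M.det ≤ m₁ ^ d :=
  trace_div_pow_le (h.posDef hm₀).posSemidef h.diag_le hd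

theorem MetricBounds.le_det {m₀ m₁ : ℝ} (hm₀ : 0 < m₀) (hd : 0 < d)
    {M : Matrix (Fin d) (Fin d) ℝ} (h : MetricBounds m₀ m₁ M) : m₀ ^ d ≤ M.det := by
  have h1 := trace_div_pow_le (h.posDef hm₀).inv.posSemidef (h.inv_diag_le hm₀) hd
  rw [det_nonsing_inv, Ring.inverse_eq_inv', inv_pow] at h1
  exact (inv_le_inv₀ (h.posDef hm₀).det_pos (pow_pos hm₀ d)).1 h1

/-- Mesh vertices may lie on the boundary, while the bounds are assumed only inside the domain; they
survive limits. -/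
theorem metricBounds_of_mem_closure {m₀ m₁ : ℝ} {M : Space d → Matrix (Fin d) (Fin d) ℝ}
    {Ω : Set (Space d)} (hM : ∀ z ∈ Ω, MetricBounds m₀ m₁ (M z))
    (hMc : ∀ z ∈ closure Ω, ∀ a b, ContinuousAt (fun y => M y a b) z) {z : Space d}
    (hz : z ∈ closure Ω) : MetricBounds m₀ m₁ (M z) := by
  have : (nhdsWithin z Ω).NeBot := mem_closure_iff_nhdsWithin_neBot.1 hz
  have hlim : ∀ a b, Filter.Tendsto (fun y => M y a b) (nhdsWithin z Ω) (nhds (M z a b)) :=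
    fun a b => (hMc z hz a b).tendsto.mono_left nhdsWithin_le_nhds
  have hmem : ∀ᶠ y in nhdsWithin z Ω, y ∈ Ω := self_mem_nhdsWithin
  have hq : ∀ u : Fin d → ℝ, Filter.Tendsto (fun y => u ⬝ᵥ (M y *ᵥ u)) (nhdsWithin z Ω)
      (nhds (u ⬝ᵥ (M z *ᵥ u))) := by
    intro u
    simp only [dotProduct, mulVec]
    exact tendsto_finsetSum _ fun i _ => (tendsto_finsetSum _ fun j _ =>
      (hlim i j).mul tendsto_const_nhds).const_mul _
  rw [metricBounds_iff]
  refine ⟨?_, fun u => ⟨?_, ?_⟩⟩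
  · ext a b
    refine tendsto_nhds_unique_of_eventuallyEq (hlim b a) (hlim a b) ?_
    filter_upwards [hmem] with y hy
    simpa using (hM y hy).isHermitian.apply a b
  · exact ge_of_tendsto (hq u) (hmem.mono fun y hy => (hM y hy).mul_le u)
  · exact le_of_tendsto (hq u) (hmem.mono fun y hy => (hM y hy).le_mul u)

theorem MetricBounds.elementMetric {V Elt : Type*} {m₀ m₁ : ℝ}
    {M : Space d → Matrix (Fin d) (Fin d) ℝ} {conn : Elt → Fin (d + 1) → V}
    {x : V → Space d} {K : Elt} (h : ∀ j, MetricBounds m₀ m₁ (M (x (conn K j)))) :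
    MetricBounds m₀ m₁ (elementMetric M conn x K) := by
  have hd : (0 : ℝ) < (d : ℝ) + 1 := by positivity
  have hq : ∀ u : Fin d → ℝ, u ⬝ᵥ (MovingMesh.elementMetric M conn x K *ᵥ u) =
      ((d : ℝ) + 1)⁻¹ * ∑ j, u ⬝ᵥ (M (x (conn K j)) *ᵥ u) := by
    intro u
    simp only [MovingMesh.elementMetric, elementVertices, smul_mulVec, dotProduct_smul,
      sum_mulVec, dotProduct_sum, smul_eq_mul]
  rw [metricBounds_iff]
  refine ⟨?_, fun u => ?_⟩
  · have h1 : ∀ j, (M (x (conn K j)))ᴴ = M (x (conn K j)) := fun j => (h j).isHermitian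
    simp only [IsHermitian, MovingMesh.elementMetric, elementVertices, conjTranspose_smul,
      conjTranspose_sum, h1, star_trivial]
  · rw [hq, ← div_eq_inv_mul, le_div_iff₀ hd, div_le_iff₀ hd]
    constructor
    · have := Finset.card_nsmul_le_sum Finset.univ (fun j => u ⬝ᵥ (M (x (conn K j)) *ᵥ u))
        (m₀ * (u ⬝ᵥ u)) fun j _ => (h j).mul_le u
      simp at this
      linarith
    · have := Finset.sum_le_card_nsmul Finset.univ (fun j => u ⬝ᵥ (M (x (conn K j)) *ᵥ u))
        (m₁ * (u ⬝ᵥ u)) fun j _ => (h j).le_mul u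
      simp at this
      linarith

end Bounds

/-! ### The pulled back metric -/

section Pullback

variable {d : ℕ}

theorem pullback_posDef {J M : Matrix (Fin d) (Fin d) ℝ} (hJ : J.det ≠ 0) (hM : M.PosDef) :
    (pullback J M).PosDef := by
  have hJ' : IsUnit J⁻¹ := by
    rw [isUnit_iff_isUnit_det, det_nonsing_inv, Ring.inverse_eq_inv']
    exact (inv_ne_zero hJ).isUnit
  have := hM.inv.mul_mul_conjTranspose_same (B := J⁻¹) (vecMul_injective_of_isUnit hJ')
  simpa [pullback] using this

theorem pullback_det (J M : Matrix (Fin d) (Fin d) ℝ) :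
    (pullback J M).det = (J.det ^ 2 * M.det)⁻¹ := by
  simp only [pullback, det_mul, det_transpose, det_nonsing_inv, Ring.inverse_eq_inv', mul_inv]
  ring

end Pullback

/-! ### Differentiability of matrix functions, entry by entry -/

section Differentiability

/-- All entries of the matrix function are differentiable at the point. -/
def EntrywiseDifferentiableAt {X n : Type*} [NormedAddCommGroup X] [NormedSpace ℝ X]
    (F : X → Matrix n n ℝ) (y : X) : Prop :=
  ∀ a b, DifferentiableAt ℝ (fun z => F z a b) y

variable {X : Type*} [NormedAddCommGroup X] [NormedSpace ℝ X]
  {n : Type*} {F G : X → Matrix n n ℝ} {y : X}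

theorem EntrywiseDifferentiableAt.transpose (hF : EntrywiseDifferentiableAt F y) :
    EntrywiseDifferentiableAt (fun z => (F z)ᵀ) y :=
  fun a b => hF b a

variable [Fintype n]

theorem EntrywiseDifferentiableAt.mul (hF : EntrywiseDifferentiableAt F y)
    (hG : EntrywiseDifferentiableAt G y) :
    EntrywiseDifferentiableAt (fun z => F z * G z) y := by
  intro a b
  simp only [mul_apply]
  exact DifferentiableAt.fun_sum fun c _ => (hF a c).mul (hG c b)

theorem EntrywiseDifferentiableAt.trace (hF : EntrywiseDifferentiableAt F y) :
    DifferentiableAt ℝ (fun z => (F z).trace) y := by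
  simp only [Matrix.trace, diag_apply]
  exact DifferentiableAt.fun_sum fun c _ => hF c c

variable [DecidableEq n]

theorem EntrywiseDifferentiableAt.det (hF : EntrywiseDifferentiableAt F y) :
    DifferentiableAt ℝ (fun z => (F z).det) y := by
  simp only [det_apply']
  refine DifferentiableAt.fun_sum fun σ _ => ?_
  exact (HasFDerivAt.finsetProd (u := Finset.univ) (g := fun i z => F z (σ i) i)
    fun i _ => (hF (σ i) i).hasFDerivAt).differentiableAt.const_mul _

theorem EntrywiseDifferentiableAt.inv (hF : EntrywiseDifferentiableAt F y)
    (h : (F y).det ≠ 0) : EntrywiseDifferentiableAt (fun z => (F z)⁻¹) y := by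
  intro a b
  simp only [inv_def, Ring.inverse_eq_inv', Matrix.smul_apply, smul_eq_mul, adjugate_apply]
  refine (hF.det.inv h).mul (EntrywiseDifferentiableAt.det fun c e => ?_)
  simp only [updateRow_apply]
  split_ifs
  · exact differentiableAt_const _
  · exact hF c e

end Differentiability

/-! ### Nonsingularity and differentiability of the discrete energy -/

section Energy

variable {X : Type*} [NormedAddCommGroup X] [NormedSpace ℝ X] {d : ℕ} {V Elt : Type*}

theorem entrywiseDifferentiableAt_edgeMatrix [Fintype V] (conn : Elt → Fin (d + 1) → V)
    {x : X → V → Space d} {y : X} (hx : DifferentiableAt ℝ x y) (K : Elt) :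
    EntrywiseDifferentiableAt (fun z => edgeMatrix (elementVertices conn (x z) K)) y := by
  intro a b
  have hx' : ∀ i, DifferentiableAt ℝ (fun z => x z i) y := differentiableAt_pi.1 hx
  have hc : ∀ i, DifferentiableAt ℝ (fun z => x z i a) y := fun i =>
    (EuclideanSpace.proj (𝕜 := ℝ) a).differentiableAt.comp y (hx' i)
  exact (hc (conn K b.succ)).sub (hc (conn K 0))

theorem jacobian_det (conn : Elt → Fin (d + 1) → V) (x ξ : V → Space d) (K : Elt) :
    (jacobian conn x ξ K).det = (edgeMatrix (elementVertices conn x K)).det *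
      ((edgeMatrix (elementVertices conn ξ K)).det)⁻¹ := by
  rw [jacobian, det_mul, det_nonsing_inv, Ring.inverse_eq_inv']

/-- The product is continuous in the vertices even where an element degenerates, as the barrier
argument requires. A vanishing computational determinant is harmless, because its inverse is then
`0` by convention. -/
theorem nonsingular_iff (conn : Elt → Fin (d + 1) → V) (x ξ : V → Space d) :
    Nonsingular conn x ξ ↔ ∀ K, 0 < (edgeMatrix (elementVertices conn x K)).det *
      (edgeMatrix (elementVertices conn ξ K)).det := by
  refine forall_congr' fun K => ?_
  rw [jacobian_det, ← div_eq_mul_inv, div_pos_iff, mul_pos_iff]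

theorem Nonsingular.det_ne_zero {conn : Elt → Fin (d + 1) → V} {x ξ : V → Space d}
    (h : Nonsingular conn x ξ) (K : Elt) :
    (edgeMatrix (elementVertices conn x K)).det ≠ 0 ∧
      (edgeMatrix (elementVertices conn ξ K)).det ≠ 0 := by
  have := ((nonsingular_iff conn x ξ).1 h K).ne'
  exact mul_ne_zero_iff.1 this

theorem simplexVolume_pos {p : Fin (d + 1) → Space d} (h : (edgeMatrix p).det ≠ 0) :
    0 < simplexVolume p :=
  div_pos (abs_pos.2 h) (by exact_mod_cast d.factorial_pos)

/-- Nonsingularity and positive definiteness keep the absolute value, square root, power and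
logarithm away from their singular points. Letting `x` and `ξ` both depend on a parameter serves the
two flows at once. -/
theorem differentiableAt_discreteEnergy [Fintype V] [Fintype Elt] (hd : 0 < d) {γ θ : ℝ}
    {M : Space d → Matrix (Fin d) (Fin d) ℝ} (conn : Elt → Fin (d + 1) → V)
    {x ξ : X → V → Space d} {y : X} (hx : DifferentiableAt ℝ x y)
    (hξ : DifferentiableAt ℝ ξ y)
    (hM : ∀ K j a b, DifferentiableAt ℝ (fun z => M z a b) (x y (conn K j)))
    (hMpos : ∀ K, (elementMetric M conn (x y) K).PosDef)
    (hns : Nonsingular conn (x y) (ξ y)) :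
    DifferentiableAt ℝ (fun z => discreteEnergy γ θ M conn (x z) (ξ z)) y := by
  have : Nonempty (Fin d) := ⟨⟨0, hd⟩⟩
  have hx' : ∀ i, DifferentiableAt ℝ (fun z => x z i) y := differentiableAt_pi.1 hx
  refine DifferentiableAt.fun_sum fun K _ => ?_
  have hE := entrywiseDifferentiableAt_edgeMatrix conn hx K
  have hE' := entrywiseDifferentiableAt_edgeMatrix conn hξ K
  have hJ : EntrywiseDifferentiableAt (fun z => jacobian conn (x z) (ξ z) K) y :=
    hE.mul (hE'.inv (hns.det_ne_zero K).2)
  have hMK : EntrywiseDifferentiableAt (fun z => elementMetric M conn (x z) K) y := by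
    intro a b
    simp only [elementMetric, Matrix.smul_apply, smul_eq_mul, Matrix.sum_apply]
    refine (DifferentiableAt.fun_sum fun j _ => ?_).const_mul _
    exact DifferentiableAt.comp (g := fun w => M w a b) y (hM K j a b) (hx' (conn K j))
  have hJi := hJ.inv (hns K).ne'
  have hA : EntrywiseDifferentiableAt (fun z => pullback (jacobian conn (x z) (ξ z) K)
      (elementMetric M conn (x z) K)) y :=
    (hJi.mul (hMK.inv (hMpos K).det_pos.ne')).mul hJi.transpose
  have hApos := pullback_posDef (hns K).ne' (hMpos K)
  refine DifferentiableAt.mul ?_ ?_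
  · simp only [simplexVolume, div_eq_mul_inv]
    exact (hE.det.abs (hns.det_ne_zero K).1).mul_const _
  · simp only [integrand]
    refine (hMK.det.sqrt (hMpos K).det_pos.ne').mul (DifferentiableAt.sub ?_ ?_)
    · exact hA.trace.rpow_const (Or.inl hApos.trace_pos.ne')
    · exact (hA.det.log hApos.det_pos.ne').const_mul _

end Energy

/-! ### Heights, inscribed balls and volumes of simplices -/

section SimplexGeometry

variable {d : ℕ}

theorem norm_sq_eq_dotProduct (v : Space d) : ‖v‖ ^ 2 = v.ofLp ⬝ᵥ v.ofLp := by
  rw [EuclideanSpace.real_norm_sq_eq, dotProduct]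
  exact Finset.sum_congr rfl fun i _ => pow_two _

theorem metricLength_one (v : Space d) : metricLength 1 v = ‖v‖ := by
  rw [metricLength, one_mulVec, ← norm_sq_eq_dotProduct, Real.sqrt_sq (norm_nonneg _)]

theorem metricLength_nonneg (M : Matrix (Fin d) (Fin d) ℝ) (v : Space d) :
    0 ≤ metricLength M v := Real.sqrt_nonneg _

theorem height_nonneg (M : Matrix (Fin d) (Fin d) ℝ) (p : Fin (d + 1) → Space d)
    (j : Fin (d + 1)) : 0 ≤ height M p j :=
  Real.iInf_nonneg fun _ => metricLength_nonneg _ _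

theorem minHeight_nonneg (M : Matrix (Fin d) (Fin d) ℝ) (p : Fin (d + 1) → Space d) :
    0 ≤ minHeight M p :=
  Real.iInf_nonneg fun _ => height_nonneg _ _ _

theorem height_le {M : Matrix (Fin d) (Fin d) ℝ} {p : Fin (d + 1) → Space d}
    {j : Fin (d + 1)} {y : Space d} (hy : y ∈ affineSpan ℝ (p '' {j}ᶜ)) :
    height M p j ≤ metricLength M (p j - y) :=
  ciInf_le (f := fun y : affineSpan ℝ (p '' {j}ᶜ) => metricLength M (p j - (y : Space d)))
    ⟨0, by rintro _ ⟨z, rfl⟩; exact metricLength_nonneg _ _⟩ ⟨y, hy⟩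

theorem minHeight_le (M : Matrix (Fin d) (Fin d) ℝ) (p : Fin (d + 1) → Space d)
    (j : Fin (d + 1)) : minHeight M p ≤ height M p j :=
  ciInf_le (f := fun j => height M p j)
    ⟨0, by rintro _ ⟨z, rfl⟩; exact height_nonneg _ _ _⟩ j

theorem le_minHeight (hd : 0 < d) {M : Matrix (Fin d) (Fin d) ℝ} {p : Fin (d + 1) → Space d}
    {a : ℝ} (h : ∀ j, ∀ y ∈ affineSpan ℝ (p '' {j}ᶜ), a ≤ metricLength M (p j - y)) :
    a ≤ minHeight M p := by
  refine le_ciInf fun j => ?_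
  have : Nontrivial (Fin (d + 1)) := Fin.nontrivial_iff_two_le.2 (by omega)
  obtain ⟨k, hk⟩ := exists_ne j
  have : Nonempty (affineSpan ℝ (p '' {j}ᶜ)) :=
    ⟨⟨p k, subset_affineSpan ℝ _ ⟨k, hk, rfl⟩⟩⟩
  exact le_ciInf fun y => h j y y.2

theorem edgeMatrix_mulVec (p : Fin (d + 1) → Space d) (c : Fin d → ℝ) :
    edgeMatrix p *ᵥ c = (∑ k, c k • (p k.succ - p 0)).ofLp := by
  ext a
  simp [edgeMatrix, mulVec, dotProduct, mul_comm]

theorem affineIndependent_iff_det_ne_zero (p : Fin (d + 1) → Space d) :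
    AffineIndependent ℝ p ↔ (edgeMatrix p).det ≠ 0 := by
  rw [affineIndependent_iff_linearIndependent_vsub ℝ p 0,
    ← linearIndependent_equiv (finSuccAboveEquiv (0 : Fin (d + 1)))]
  rw [← isUnit_iff_ne_zero, ← isUnit_iff_isUnit_det, ← linearIndependent_cols_iff_isUnit,
    ← LinearMap.linearIndependent_iff (WithLp.linearEquiv 2 ℝ (Fin d → ℝ)).toLinearMap
      (LinearEquiv.ker _)]
  rfl

/-- The barycentric coordinates of a nondegenerate simplex. -/
noncomputable def simplexBasis (p : Fin (d + 1) → Space d) (hp : AffineIndependent ℝ p) :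
    AffineBasis (Fin (d + 1)) ℝ (Space d) :=
  ⟨p, hp, hp.affineSpan_eq_top_iff_card_eq_finrank_add_one.2 (by simp)⟩

theorem simplexBasis_coe (p : Fin (d + 1) → Space d) (hp : AffineIndependent ℝ p) :
    ⇑(simplexBasis p hp) = p := rfl

theorem affineMap_eq_zero_of_mem_affineSpan {f : Space d →ᵃ[ℝ] ℝ} {s : Set (Space d)}
    (h : ∀ z ∈ s, f z = 0) {y : Space d} (hy : y ∈ affineSpan ℝ s) : f y = 0 := by
  have h1 : f y ∈ (affineSpan ℝ s).map f := AffineSubspace.mem_map_of_mem f hy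
  rw [AffineSubspace.map_span] at h1
  have h2 : f '' s ⊆ {0} := by
    rintro _ ⟨z, hz, rfl⟩
    exact h z hz
  have := affineSpan_mono ℝ h2 h1
  rwa [AffineSubspace.mem_affineSpan_singleton] at this

theorem coord_eq_zero_of_mem_facet {p : Fin (d + 1) → Space d} (hp : AffineIndependent ℝ p)
    {j : Fin (d + 1)} {y : Space d} (hy : y ∈ affineSpan ℝ (p '' {j}ᶜ)) :
    (simplexBasis p hp).coord j y = 0 := by
  refine affineMap_eq_zero_of_mem_affineSpan ?_ hy
  rintro _ ⟨k, hk, rfl⟩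
  exact (simplexBasis p hp).coord_apply_ne (Ne.symm hk)

theorem coord_mem_Icc_of_mem_simplex {p : Fin (d + 1) → Space d} (hp : AffineIndependent ℝ p)
    (j : Fin (d + 1)) {y : Space d} (hy : y ∈ simplex p) :
    (simplexBasis p hp).coord j y ∈ Set.Icc (0 : ℝ) 1 := by
  have h : simplex p ⊆ (simplexBasis p hp).coord j ⁻¹' Set.Icc 0 1 := by
    refine convexHull_min ?_ ((convex_Icc 0 1).affine_preimage _)
    rintro _ ⟨k, rfl⟩
    have : (simplexBasis p hp).coord j (p k) = if j = k then 1 else 0 :=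
      (simplexBasis p hp).coord_apply j k
    rw [Set.mem_preimage, this]
    split_ifs <;> simp
  exact h hy

/-- Along `p j - y` the barycentric coordinate `j` grows at unit rate. Going from the center of the
ball by a radius in both senses along this vector changes the coordinate by `s / ‖p j - y‖` in
total, and it must stay in `[0, 1]`. -/
theorem ball_diameter_le {p : Fin (d + 1) → Space d} (hp : AffineIndependent ℝ p)
    {j : Fin (d + 1)} {y : Space d} (hy : y ∈ affineSpan ℝ (p '' {j}ᶜ)) {s : ℝ} (hs : 0 ≤ s)
    {c : Space d} (hc : Metric.closedBall c (s / 2) ⊆ simplex p) : s ≤ ‖p j - y‖ := by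
  set f := (simplexBasis p hp).coord j with hf
  have h1 : f.linear (p j - y) = 1 := by
    have h2 := f.linearMap_vsub (p j) y
    have h3 : f (p j) = 1 := (simplexBasis p hp).coord_apply_eq j
    rw [coord_eq_zero_of_mem_facet hp hy, h3] at h2
    simpa using h2
  have hv : 0 < ‖p j - y‖ := by
    rw [norm_pos_iff]
    intro h0
    rw [h0, map_zero] at h1
    exact zero_ne_one h1
  have hmem : ∀ ε : ℝ, |ε| = 1 → (ε * (s / (2 * ‖p j - y‖))) • (p j - y) + c ∈ simplex p := by
    intro ε hε
    refine hc ?_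
    rw [mem_closedBall_iff_norm, add_sub_cancel_right, norm_smul, Real.norm_eq_abs, abs_mul, hε,
      one_mul, abs_of_nonneg (by positivity)]
    exact le_of_eq (by field_simp)
  have hfv : ∀ ε : ℝ, f ((ε * (s / (2 * ‖p j - y‖))) • (p j - y) + c) =
      ε * (s / (2 * ‖p j - y‖)) + f c := by
    intro ε
    have := f.map_vadd c ((ε * (s / (2 * ‖p j - y‖))) • (p j - y))
    rw [map_smul, h1] at this
    simpa using this
  have ha := (coord_mem_Icc_of_mem_simplex hp j (hmem 1 (by simp))).2
  have hb := (coord_mem_Icc_of_mem_simplex hp j (hmem (-1) (by simp))).1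
  rw [← hf, hfv] at ha hb
  have : s / (2 * ‖p j - y‖) = s / ‖p j - y‖ / 2 := by field_simp
  rw [this] at ha hb
  exact (div_le_one hv).1 (by linarith)

theorem inDiameter_le {q : Fin (d + 1) → Space d} {L : ℝ}
    (h : ∀ s : ℝ, 0 ≤ s → ∀ c : Space d, Metric.closedBall c (s / 2) ⊆ simplex q → s ≤ L) :
    inDiameter q ≤ L := by
  -- The degenerate ball at a vertex, with `s = 0`, shows that the set is nonempty.
  refine csSup_le ⟨0, le_rfl, q 0, ?_⟩ ?_
  · rw [zero_div, Metric.closedBall_zero, Set.singleton_subset_iff]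
    exact subset_convexHull ℝ _ ⟨0, rfl⟩
  · rintro s ⟨hs, c, hc⟩
    exact h s hs c hc

/-- The affine map between two simplices maps facets to facets. -/
theorem exists_mem_facet_image {p q : Fin (d + 1) → Space d} (hp : (edgeMatrix p).det ≠ 0)
    {j : Fin (d + 1)} {y : Space d} (hy : y ∈ affineSpan ℝ (p '' {j}ᶜ)) :
    ∃ y' ∈ affineSpan ℝ (q '' {j}ᶜ),
      (q j - y').ofLp = (edgeMatrix q * (edgeMatrix p)⁻¹) *ᵥ (p j - y).ofLp := by
  set L : Space d →ₗ[ℝ] Space d := Matrix.toEuclideanLin (edgeMatrix q * (edgeMatrix p)⁻¹) with hL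
  have hLv : ∀ v, (L v).ofLp = (edgeMatrix q * (edgeMatrix p)⁻¹) *ᵥ v.ofLp := fun v => rfl
  let ψ : Space d →ᵃ[ℝ] Space d := AffineMap.mk' (fun z => L (z - p 0) + q 0) L (p 0)
    (fun z => by simp)
  have hψ : ∀ z, ψ z = L (z - p 0) + q 0 := fun z => rfl
  have hψp : ∀ k, ψ (p k) = q k := by
    intro k
    rw [hψ]
    refine Fin.cases ?_ (fun k => ?_) k
    · simp
    · rw [← eq_sub_iff_add_eq]
      apply WithLp.ofLp_injective 2
      have h1 : (p k.succ - p 0).ofLp = edgeMatrix p *ᵥ Pi.single k 1 := by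
        rw [mulVec_single_one]; rfl
      have h2 : (q k.succ - q 0).ofLp = edgeMatrix q *ᵥ Pi.single k 1 := by
        rw [mulVec_single_one]; rfl
      rw [hLv, h1, h2, mulVec_mulVec, Matrix.mul_assoc, nonsing_inv_mul _ hp.isUnit,
        Matrix.mul_one]
  refine ⟨ψ y, ?_, ?_⟩
  · have h1 : ψ y ∈ (affineSpan ℝ (p '' {j}ᶜ)).map ψ := AffineSubspace.mem_map_of_mem ψ hy
    rw [AffineSubspace.map_span, ← Set.image_comp] at h1
    have : (⇑ψ ∘ p) = q := funext hψp
    rwa [this] at h1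
  · rw [← hLv, ← hψp j, hψ, hψ]
    congr 1
    rw [add_sub_add_right_eq_sub, ← map_sub]
    congr 1
    abel

/-- The inverse Jacobian carries a vector `u` from a facet to the opposite vertex of `p` to such a
vector of `q`, which no inscribed ball exceeds in diameter. It stretches `u` at most by `√(tr A)`,
from the length in `M` to the Euclidean length. -/
theorem inDiameter_le_sqrt_trace_mul_minHeight (hd : 0 < d) {p q : Fin (d + 1) → Space d}
    (hp : (edgeMatrix p).det ≠ 0) (hq : (edgeMatrix q).det ≠ 0)
    {M : Matrix (Fin d) (Fin d) ℝ} (hM : M.PosDef) :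
    inDiameter q ≤ Real.sqrt (pullback (edgeMatrix p * (edgeMatrix q)⁻¹) M).trace *
      minHeight M p := by
  have : Nonempty (Fin d) := ⟨⟨0, hd⟩⟩
  have hJ : (edgeMatrix p * (edgeMatrix q)⁻¹).det ≠ 0 := by
    rw [det_mul, det_nonsing_inv, Ring.inverse_eq_inv']
    exact mul_ne_zero hp (inv_ne_zero hq)
  have htr := (pullback_posDef hJ hM).trace_pos
  have hinv : (edgeMatrix p * (edgeMatrix q)⁻¹)⁻¹ = edgeMatrix q * (edgeMatrix p)⁻¹ := by
    rw [Matrix.mul_inv_rev, nonsing_inv_nonsing_inv _ hq.isUnit]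
  refine inDiameter_le fun s hs c hc => ?_
  rw [← div_le_iff₀' (Real.sqrt_pos.2 htr)]
  refine le_minHeight hd fun j y hy => ?_
  rw [div_le_iff₀' (Real.sqrt_pos.2 htr)]
  obtain ⟨y', hy', hyy⟩ := exists_mem_facet_image (q := q) hp hy
  refine (ball_diameter_le ((affineIndependent_iff_det_ne_zero q).2 hq) hy' hs hc).trans ?_
  rw [metricLength, ← Real.sqrt_mul htr.le]
  refine Real.le_sqrt_of_sq_le ?_
  rw [norm_sq_eq_dotProduct, hyy, pullback, hinv]
  exact mulVec_dotProduct_self_le hM _ _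

/-- Here `pullback E M` is the inverse `(Eᵀ M E)⁻¹` of the Gram matrix of the edges. Its diagonal
entry `g` is the squared dual length of the gradient `w` of a barycentric coordinate, and the
`M`-normal vector `u = g⁻¹ M⁻¹ w` leads from the hyperplane of the facet to the vertex, with squared
length `g⁻¹`. -/
theorem height_succ_le {p : Fin (d + 1) → Space d} (hp : (edgeMatrix p).det ≠ 0)
    {M : Matrix (Fin d) (Fin d) ℝ} (hM : M.PosDef) (j : Fin d) :
    height M p j.succ ^ 2 ≤ (pullback (edgeMatrix p) M j j)⁻¹ := by
  set E := edgeMatrix p with hE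
  set g := pullback E M j j with hg
  have hgpos : 0 < g := (pullback_posDef hp hM).diag_pos
  set w : Fin d → ℝ := (E⁻¹)ᵀ *ᵥ Pi.single j 1 with hw
  set u : Fin d → ℝ := g⁻¹ • (M⁻¹ *ᵥ w) with hu
  set c : Fin d → ℝ := E⁻¹ *ᵥ u with hc
  have hEc : E *ᵥ c = u := by
    rw [hc, mulVec_mulVec, mul_nonsing_inv _ hp.isUnit, one_mulVec]
  have hcj : c j = 1 := by
    have : c = g⁻¹ • (pullback E M *ᵥ Pi.single j 1) := by
      simp only [hc, hu, hw, pullback, mulVec_smul, mulVec_mulVec, Matrix.mul_assoc]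
    rw [this, mulVec_single_one]
    simp only [Pi.smul_apply, smul_eq_mul, col_apply]
    exact inv_mul_cancel₀ hgpos.ne'
  have hMu : M *ᵥ u = g⁻¹ • w := by
    rw [hu, mulVec_smul, mulVec_mulVec, mul_nonsing_inv _ hM.det_pos.ne'.isUnit, one_mulVec]
  have huMu : u ⬝ᵥ (M *ᵥ u) = g⁻¹ := by
    rw [hMu, dotProduct_smul, hw, dotProduct_mulVec, ← mulVec_transpose, transpose_transpose,
      ← hc, dotProduct_single, hcj, mul_one, smul_eq_mul, mul_one]
  have hy : p j.succ - WithLp.toLp 2 u ∈ affineSpan ℝ (p '' {j.succ}ᶜ) := by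
    have h0 : p 0 ∈ affineSpan ℝ (p '' {j.succ}ᶜ) :=
      subset_affineSpan ℝ _ ⟨0, (Fin.succ_ne_zero j).symm, rfl⟩
    have hsum : WithLp.toLp 2 u = ∑ k, c k • (p k.succ - p 0) := by
      apply WithLp.ofLp_injective 2
      rw [← edgeMatrix_mulVec, ← hE, hEc]
    have heq : p j.succ - WithLp.toLp 2 u =
        (-∑ k ∈ Finset.univ.erase j, c k • (p k.succ - p 0)) + p 0 := by
      rw [hsum, ← Finset.add_sum_erase _ _ (Finset.mem_univ j), hcj, one_smul]
      abel
    rw [heq]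
    refine AffineSubspace.vadd_mem_of_mem_direction ?_ h0
    refine Submodule.neg_mem _ (Submodule.sum_mem _ fun k hk => Submodule.smul_mem _ _ ?_)
    refine AffineSubspace.vsub_mem_direction (subset_affineSpan ℝ _ ⟨k.succ, ?_, rfl⟩) h0
    simpa using Finset.ne_of_mem_erase hk
  have h := height_le (M := M) hy
  rw [sub_sub_cancel, metricLength, huMu] at h
  have h2 := pow_le_pow_left₀ (height_nonneg _ _ _) h 2
  rwa [Real.sq_sqrt (inv_nonneg.2 hgpos.le)] at h2

/-- All diagonal entries of the inverse Gram matrix are at most `a⁻²`, so its determinant is at most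
`a^(-2d)` by the arithmetic-geometric mean inequality. The `d` heights over the facets through
vertex `0` suffice. -/
theorem minHeight_pow_le (hd : 0 < d) {p : Fin (d + 1) → Space d}
    (hp : (edgeMatrix p).det ≠ 0) {M : Matrix (Fin d) (Fin d) ℝ} (hM : M.PosDef) :
    minHeight M p ^ d ≤ |(edgeMatrix p).det| * Real.sqrt M.det := by
  rcases (minHeight_nonneg M p).eq_or_lt with h0 | h0
  · rw [← h0, zero_pow hd.ne']
    positivity
  have hG := pullback_posDef hp hM
  have hdiag : ∀ j, pullback (edgeMatrix p) M j j ≤ (minHeight M p ^ 2)⁻¹ := by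
    intro j
    have h1 := (pow_le_pow_left₀ h0.le (minHeight_le M p j.succ) 2).trans
      (height_succ_le hp hM j)
    rwa [le_inv_comm₀ (pow_pos h0 2) hG.diag_pos] at h1
  have h2 := trace_div_pow_le hG.posSemidef hdiag hd
  rw [pullback_det, inv_pow] at h2
  have hdM := hM.det_pos
  have h3 := (inv_le_inv₀ (mul_pos (pow_pos (abs_pos.2 hp) 2 |>.trans_eq (sq_abs _)) hdM)
    (pow_pos (pow_pos h0 2) d)).1 h2
  have h4 : (minHeight M p ^ d) ^ 2 ≤ (|(edgeMatrix p).det| * Real.sqrt M.det) ^ 2 := by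
    rw [mul_pow, sq_abs, Real.sq_sqrt hdM.le, ← pow_mul, mul_comm d, pow_mul]
    exact h3
  exact le_of_sq_le_sq h4 (by positivity)

theorem minHeight_one_le_diam (hd : 0 < d) (p : Fin (d + 1) → Space d) :
    minHeight 1 p ≤ Metric.diam (simplex p) := by
  have hne : (⟨1, by omega⟩ : Fin (d + 1)) ≠ 0 := by
    simp [Fin.ext_iff]
  refine (minHeight_le 1 p ⟨1, by omega⟩).trans ((height_le (subset_affineSpan ℝ _
    ⟨0, hne.symm, rfl⟩)).trans ?_)
  rw [metricLength_one, ← dist_eq_norm]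
  refine Metric.dist_le_diam_of_mem ?_ (subset_convexHull ℝ _ ⟨_, rfl⟩)
    (subset_convexHull ℝ _ ⟨_, rfl⟩)
  exact (isBounded_convexHull.2 (Set.finite_range p).isBounded)

theorem diam_simplex_pos (hd : 0 < d) {p : Fin (d + 1) → Space d}
    (hp : AffineIndependent ℝ p) : 0 < Metric.diam (simplex p) := by
  have hne : (⟨1, by omega⟩ : Fin (d + 1)) ≠ 0 := by
    simp [Fin.ext_iff]
  refine Metric.diam_pos ⟨_, subset_convexHull ℝ _ ⟨_, rfl⟩, _, subset_convexHull ℝ _ ⟨_, rfl⟩,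
    hp.injective.ne hne⟩ (isBounded_convexHull.2 (Set.finite_range p).isBounded)

end SimplexGeometry

/-! ### Existence of coercivity constants -/

section Coercivity

variable {d : ℕ}

/-- A logarithm is absorbed by half of a power, through `log z ≤ z - 1` at `z = k u^p`. -/
theorem exists_half_rpow_sub_le {c p D : ℝ} (hc : 0 ≤ c) (hp : 0 < p) (hD : 0 < D) :
    ∃ b : ℝ, 0 ≤ b ∧ ∀ u : ℝ, 0 < u →
      1 / 2 * u ^ p - b ≤ u ^ p - c * (D * Real.log (u / D)) := by
  set e := c * D / p with he
  have he0 : 0 ≤ e := by positivity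
  -- Chosen so that `e k ≤ 1/2`; adding one keeps `k` meaningful when `e = 0`.
  set k := 1 / (2 * (e + 1)) with hk
  have hkpos : 0 < k := by positivity
  refine ⟨|e * (1 + Real.log k)| + |c * D * Real.log D|, by positivity, fun u hu => ?_⟩
  have hup : 0 < u ^ p := Real.rpow_pos_of_pos hu p
  have h1 := Real.log_le_sub_one_of_pos (mul_pos hkpos hup)
  rw [Real.log_mul hkpos.ne' hup.ne', Real.log_rpow hu] at h1
  have h2 : c * (D * Real.log (u / D)) = e * (p * Real.log u) - c * D * Real.log D := by
    rw [Real.log_div hu.ne' hD.ne', he]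
    field_simp
  have h3 : e * (p * Real.log u) ≤ e * (k * u ^ p) - e * (1 + Real.log k) := by
    have := mul_le_mul_of_nonneg_left h1 he0
    linarith
  have h4 : e * (k * u ^ p) ≤ 1 / 2 * u ^ p := by
    rw [← mul_assoc]
    refine mul_le_mul_of_nonneg_right ?_ hup.le
    rw [hk, mul_one_div, div_le_div_iff₀ (by positivity) (by norm_num)]
    linarith
  have h5 := neg_abs_le (e * (1 + Real.log k))
  have h6 := neg_abs_le (c * D * Real.log D)
  rw [h2]
  linarith

theorem log_det_le {A : Matrix (Fin d) (Fin d) ℝ} (hd : 0 < d) (hA : A.PosDef) :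
    Real.log A.det ≤ d * Real.log (A.trace / d) := by
  have : Nonempty (Fin d) := ⟨⟨0, hd⟩⟩
  have h := det_le_trace_div_pow hA.posSemidef
  rw [Fintype.card_fin] at h
  rw [← Real.log_pow]
  exact Real.log_le_log hA.det_pos h

/-- `ln det A ≤ d ln(tr A / d)` reduces the claim to a scalar inequality in the trace. The bounds of
`√(det M)` from below and above then enter `α` and `β` respectively. -/
theorem exists_isCoercive (hd : 0 < d) {γ θ m₀ m₁ : ℝ} (hγ : 1 < γ) (hθ : 0 ≤ θ)
    (hm₀ : 0 < m₀) :
    ∃ α β : ℝ, 0 < α ∧ 0 ≤ β ∧ IsCoercive d γ θ m₀ m₁ α β := by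
  have hD : (0 : ℝ) < d := by exact_mod_cast hd
  have : Nonempty (Fin d) := ⟨⟨0, hd⟩⟩
  set p := (d : ℝ) * γ / 2 with hp
  have hp0 : 0 < p := by positivity
  set c := (d : ℝ) ^ p * (γ / 2) * θ ^ p with hc
  have hc0 : 0 ≤ c := by positivity
  obtain ⟨b, hb, hbu⟩ := exists_half_rpow_sub_le hc0 hp0 hD
  refine ⟨Real.sqrt (m₀ ^ d) / 2, Real.sqrt (m₁ ^ d) * b,
    half_pos (Real.sqrt_pos.2 (pow_pos hm₀ d)), by positivity, fun J M hJ hM => ?_⟩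
  have hA := pullback_posDef hJ.ne' (hM.posDef hm₀)
  have h1 := hbu _ hA.trace_pos
  have h2 := mul_le_mul_of_nonneg_left (log_det_le hd hA) hc0
  have hs0 := Real.sqrt_le_sqrt (hM.le_det hm₀ hd)
  have hs1 := Real.sqrt_le_sqrt (hM.det_le hm₀ hd)
  have htr : 0 < (pullback J M).trace ^ p := Real.rpow_pos_of_pos hA.trace_pos p
  rw [integrand, ← hp, ← hc]
  have h3 := mul_le_mul_of_nonneg_left (h1.trans (sub_le_sub_left h2 _))
    (Real.sqrt_nonneg M.det)
  refine le_trans ?_ h3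
  nlinarith

end Coercivity

/-! ### Positivity of the scaling factor -/

section Theta

variable {d : ℕ}

theorem theta_nonneg (M : Space d → Matrix (Fin d) (Fin d) ℝ) (Ωp Ωc : Set (Space d)) :
    0 ≤ theta M Ωp Ωc :=
  Real.rpow_nonneg (div_nonneg (integral_nonneg fun _ => Real.sqrt_nonneg _)
    measureReal_nonneg) _

/-- Positivity gives the logarithm in the integrand a nonzero coefficient, on which the
computational flow relies. -/
theorem theta_pos {M : Space d → Matrix (Fin d) (Fin d) ℝ} {Ωp Ωc : Set (Space d)}
    (hΩp : IsOpen Ωp) (hΩc : IsOpen Ωc) (hp : Ωp.Nonempty) (hc : Ωc.Nonempty)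
    (hpK : IsCompact (closure Ωp)) (hcK : IsCompact (closure Ωc))
    (hM : ∀ z ∈ Ωp, (M z).PosDef)
    (hMdiff : ∀ z ∈ closure Ωp, ∀ a b, DifferentiableAt ℝ (fun y => M y a b) z) :
    0 < theta M Ωp Ωc := by
  refine Real.rpow_pos_of_pos (div_pos ?_ ?_) _
  · have hcont : ContinuousOn (fun z => Real.sqrt (M z).det) (closure Ωp) := by
      intro z hz
      have : EntrywiseDifferentiableAt M z := hMdiff z hz
      exact this.det.continuousAt.sqrt.continuousWithinAt
    have hint : IntegrableOn (fun z => Real.sqrt (M z).det) Ωp :=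
      (hcont.integrableOn_compact hpK).mono_set subset_closure
    rw [setIntegral_pos_iff_support_of_nonneg_ae
      (Filter.Eventually.of_forall fun z => Real.sqrt_nonneg _) hint]
    have : Function.support (fun z => Real.sqrt (M z).det) ∩ Ωp = Ωp :=
      Set.inter_eq_right.2 fun z hz => (Real.sqrt_pos.2 (hM z hz).det_pos).ne'
    rw [this]
    exact hΩp.measure_pos _ hp
  · exact ENNReal.toReal_pos (hΩc.measure_pos _ hc).ne'
      ((measure_mono subset_closure).trans_lt hcK.measure_lt_top).ne

end Theta

/-! ### From the total energy to a single element -/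

section EnergyEstimates

variable {d : ℕ} {V Elt : Type*} {conn : Elt → Fin (d + 1) → V}
  {x ξ : V → Space d} {γ θ m₀ m₁ α β vol E₀ : ℝ} {M : Space d → Matrix (Fin d) (Fin d) ℝ}

theorem simplexVolume_nonneg (p : Fin (d + 1) → Space d) : 0 ≤ simplexVolume p := by
  unfold simplexVolume
  positivity

theorem coercive_term_le (hco : IsCoercive d γ θ m₀ m₁ α β)
    (hM : ∀ K, MetricBounds m₀ m₁ (elementMetric M conn x K)) (hns : Nonsingular conn x ξ)
    (K : Elt) :
    α * (simplexVolume (elementVertices conn x K) *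
      (pullback (jacobian conn x ξ K) (elementMetric M conn x K)).trace ^ ((d : ℝ) * γ / 2)) ≤
    simplexVolume (elementVertices conn x K) *
      integrand γ θ (pullback (jacobian conn x ξ K) (elementMetric M conn x K))
      (pullback (jacobian conn x ξ K) (elementMetric M conn x K)).det (elementMetric M conn x K) +
    β * simplexVolume (elementVertices conn x K) := by
  have := mul_le_mul_of_nonneg_left (hco _ _ (hns K) (hM K))
    (simplexVolume_nonneg (elementVertices conn x K))
  linarith

variable [Fintype Elt]

/-- With `β|K|` added, every summand of the energy dominates a nonnegative term, so one of these
terms is at most the whole sum. -/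
theorem trace_rpow_le_energy (hd : 0 < d) (hm₀ : 0 < m₀) (hα : 0 < α) (hβ : 0 ≤ β)
    (hco : IsCoercive d γ θ m₀ m₁ α β)
    (hM : ∀ K, MetricBounds m₀ m₁ (elementMetric M conn x K)) (hns : Nonsingular conn x ξ)
    (hvol : ∑ K, simplexVolume (elementVertices conn x K) ≤ vol)
    (hE : discreteEnergy γ θ M conn x ξ ≤ E₀) (K : Elt) :
    α * (simplexVolume (elementVertices conn x K) *
      (pullback (jacobian conn x ξ K) (elementMetric M conn x K)).trace ^ ((d : ℝ) * γ / 2)) ≤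
    β * vol + E₀ := by
  have : Nonempty (Fin d) := ⟨⟨0, hd⟩⟩
  have h1 := Finset.sum_le_sum fun K (_ : K ∈ Finset.univ) => coercive_term_le hco hM hns K
  rw [Finset.sum_add_distrib, ← Finset.mul_sum _ _ β] at h1
  have h2 := Finset.single_le_sum (f := fun K => α * (simplexVolume (elementVertices conn x K) *
      (pullback (jacobian conn x ξ K) (elementMetric M conn x K)).trace ^ ((d : ℝ) * γ / 2)))
      (fun K _ => mul_nonneg hα.le (mul_nonneg (simplexVolume_nonneg _) (Real.rpow_nonneg
        (pullback_posDef (hns K).ne' ((hM K).posDef hm₀)).trace_pos.le _))) (Finset.mem_univ K)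
  have h3 := mul_le_mul_of_nonneg_left hvol hβ
  simp only [discreteEnergy] at hE
  linarith

/-- The same argument, but keeping the integrand itself, whose logarithm is lost in the coercivity
bound. -/
theorem integrand_term_le_energy (hd : 0 < d) (hm₀ : 0 < m₀) (hα : 0 < α) (hβ : 0 ≤ β)
    (hco : IsCoercive d γ θ m₀ m₁ α β)
    (hM : ∀ K, MetricBounds m₀ m₁ (elementMetric M conn x K)) (hns : Nonsingular conn x ξ)
    (hvol : ∑ K, simplexVolume (elementVertices conn x K) ≤ vol)
    (hE : discreteEnergy γ θ M conn x ξ ≤ E₀) (K : Elt) :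
    simplexVolume (elementVertices conn x K) *
      integrand γ θ (pullback (jacobian conn x ξ K) (elementMetric M conn x K))
      (pullback (jacobian conn x ξ K) (elementMetric M conn x K)).det
      (elementMetric M conn x K) ≤ β * vol + E₀ := by
  have : Nonempty (Fin d) := ⟨⟨0, hd⟩⟩
  have h2 := Finset.single_le_sum (f := fun K => simplexVolume (elementVertices conn x K) *
      integrand γ θ (pullback (jacobian conn x ξ K) (elementMetric M conn x K))
      (pullback (jacobian conn x ξ K) (elementMetric M conn x K)).det (elementMetric M conn x K) +
    β * simplexVolume (elementVertices conn x K))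
      (fun K _ => le_trans (mul_nonneg hα.le (mul_nonneg (simplexVolume_nonneg _)
        (Real.rpow_nonneg (pullback_posDef (hns K).ne' ((hM K).posDef hm₀)).trace_pos.le _)))
        (coercive_term_le hco hM hns K)) (Finset.mem_univ K)
  rw [Finset.sum_add_distrib, ← Finset.mul_sum _ _ β] at h2
  have h3 := mul_le_mul_of_nonneg_left hvol hβ
  have h4 := mul_nonneg hβ (simplexVolume_nonneg (elementVertices conn x K))
  simp only [discreteEnergy] at hE
  linarith

end EnergyEstimates

/-! ### Energy barriers against collapsing elements -/

section DeterminantBounds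

variable {d : ℕ} {γ θ m₀ m₁ α B : ℝ}

/-- A bound for the trace of the pulled back metric bounds the volume of the physical element from
below. -/
theorem det_rpow_le_of_trace_rpow_le (hd : 0 < d) (hγ : 1 < γ) (hm₀ : 0 < m₀) (hα : 0 < α)
    {p q : Fin (d + 1) → Space d} (hp : (edgeMatrix p).det ≠ 0) (hq : (edgeMatrix q).det ≠ 0)
    {M : Matrix (Fin d) (Fin d) ℝ} (hM : MetricBounds m₀ m₁ M)
    (h : α * (simplexVolume p * (pullback (edgeMatrix p * (edgeMatrix q)⁻¹) M).trace ^
      ((d : ℝ) * γ / 2)) ≤ B) :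
    α / d.factorial * (|(edgeMatrix q).det| ^ γ * ((m₁ ^ d) ^ (γ / 2))⁻¹) ≤
      B * |(edgeMatrix p).det| ^ (γ - 1) := by
  have : Nonempty (Fin d) := ⟨⟨0, hd⟩⟩
  have hD : (1 : ℝ) ≤ d := by exact_mod_cast hd
  set e := |(edgeMatrix p).det| with he
  set f := |(edgeMatrix q).det| with hf
  have he0 : 0 < e := abs_pos.2 hp
  have hf0 : 0 < f := abs_pos.2 hq
  have hMpos := hM.posDef hm₀
  have hJ : (edgeMatrix p * (edgeMatrix q)⁻¹).det ≠ 0 := by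
    rw [det_mul, det_nonsing_inv, Ring.inverse_eq_inv']
    exact mul_ne_zero hp (inv_ne_zero hq)
  set A := pullback (edgeMatrix p * (edgeMatrix q)⁻¹) M with hA
  have hApos : A.PosDef := pullback_posDef hJ hMpos
  have hdet : A.det = f ^ 2 / (e ^ 2 * M.det) := by
    rw [hA, pullback_det, det_mul, det_nonsing_inv, Ring.inverse_eq_inv', he, hf, sq_abs, sq_abs]
    field_simp
  have h1 : A.det ≤ A.trace ^ d := by
    have h := det_le_trace_div_pow hApos.posSemidef
    rw [Fintype.card_fin] at h
    refine h.trans (pow_le_pow_left₀ (div_nonneg hApos.trace_pos.le (by positivity)) ?_ d)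
    exact div_le_self hApos.trace_pos.le hD
  have h2 : A.det ^ (γ / 2) ≤ A.trace ^ ((d : ℝ) * γ / 2) := by
    refine (Real.rpow_le_rpow hApos.det_pos.le h1 (by positivity)).trans_eq ?_
    rw [← Real.rpow_natCast, ← Real.rpow_mul hApos.trace_pos.le]
    congr 1
    ring
  have hm1 : 0 < m₁ := hm₀.trans_le (hM.le hd)
  have h3 : f ^ 2 / (e ^ 2 * m₁ ^ d) ≤ A.det := by
    rw [hdet]
    have := hM.det_le hm₀ hd
    have := hMpos.det_pos
    gcongr
  have h4 : f ^ γ * (e ^ γ)⁻¹ * ((m₁ ^ d) ^ (γ / 2))⁻¹ ≤ A.trace ^ ((d : ℝ) * γ / 2) := by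
    refine le_trans (le_of_eq ?_) ((Real.rpow_le_rpow (by positivity) h3
      (by positivity : 0 ≤ γ / 2)).trans h2)
    have hsq : ∀ z : ℝ, 0 < z → (z ^ 2) ^ (γ / 2) = z ^ γ := by
      intro z hz
      rw [← Real.rpow_natCast, ← Real.rpow_mul hz.le]
      congr 1
      push_cast
      ring
    rw [Real.div_rpow (by positivity) (by positivity), Real.mul_rpow (by positivity)
      (by positivity), hsq e he0, hsq f hf0]
    field_simp
  have h5 : α * (e / d.factorial * (f ^ γ * (e ^ γ)⁻¹ * ((m₁ ^ d) ^ (γ / 2))⁻¹)) ≤ B := by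
    refine le_trans ?_ h
    rw [simplexVolume, ← he]
    gcongr
  have heγ : 0 < e ^ (γ - 1) := Real.rpow_pos_of_pos he0 _
  refine le_trans (le_of_eq ?_) (mul_le_mul_of_nonneg_right h5 heγ.le)
  -- The volume supplies one factor `e` against `e^(-γ)`; what remains is the negative power
  -- `e^(-(γ-1))`, which is the barrier.
  have h6 : e ^ γ = e ^ (γ - 1) * e := by
    rw [← Real.rpow_add_one he0.ne']
    congr 1
    ring
  rw [h6]
  field_simp

/-- A bound for the integrand bounds the volume of the computational element from below. -/
theorem exp_le_det_sq_of_integrand_le (hd : 0 < d) (hγ : 1 < γ) (hθ : 0 < θ)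
    {p q : Fin (d + 1) → Space d} (hp : (edgeMatrix p).det ≠ 0) (hq : (edgeMatrix q).det ≠ 0)
    {M : Matrix (Fin d) (Fin d) ℝ} (hM : M.PosDef)
    (h : simplexVolume p * integrand γ θ (pullback (edgeMatrix p * (edgeMatrix q)⁻¹) M)
      (pullback (edgeMatrix p * (edgeMatrix q)⁻¹) M).det M ≤ B) :
    Real.exp (-(B / (simplexVolume p * Real.sqrt M.det *
      ((d : ℝ) ^ ((d : ℝ) * γ / 2) * (γ / 2) * θ ^ ((d : ℝ) * γ / 2))))) *
      ((edgeMatrix p).det ^ 2 * M.det) ≤ (edgeMatrix q).det ^ 2 := by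
  have : Nonempty (Fin d) := ⟨⟨0, hd⟩⟩
  have hD : (0 : ℝ) < d := by exact_mod_cast hd
  have hJ : (edgeMatrix p * (edgeMatrix q)⁻¹).det ≠ 0 := by
    rw [det_mul, det_nonsing_inv, Ring.inverse_eq_inv']
    exact mul_ne_zero hp (inv_ne_zero hq)
  set A := pullback (edgeMatrix p * (edgeMatrix q)⁻¹) M with hA
  have hApos : A.PosDef := pullback_posDef hJ hM
  have hdet : A.det = (edgeMatrix q).det ^ 2 / ((edgeMatrix p).det ^ 2 * M.det) := by
    rw [hA, pullback_det, det_mul, det_nonsing_inv, Ring.inverse_eq_inv']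
    field_simp
  have hpM : 0 < (edgeMatrix p).det ^ 2 * M.det := mul_pos (by positivity) hM.det_pos
  rw [← le_div_iff₀ hpM, ← hdet, ← Real.le_log_iff_exp_le hApos.det_pos]
  set c := (d : ℝ) ^ ((d : ℝ) * γ / 2) * (γ / 2) * θ ^ ((d : ℝ) * γ / 2) with hc
  have hc0 : 0 < c := by positivity
  have hs : 0 < simplexVolume p * Real.sqrt M.det :=
    mul_pos (simplexVolume_pos hp) (Real.sqrt_pos.2 hM.det_pos)
  rw [neg_le, le_div_iff₀ (mul_pos hs hc0)]
  rw [integrand, ← hc] at h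
  -- The trace term only helps and is dropped, so that the bound controls the logarithm alone.
  have htr : 0 ≤ A.trace ^ ((d : ℝ) * γ / 2) := Real.rpow_nonneg hApos.trace_pos.le _
  nlinarith [mul_nonneg hs.le htr]

end DeterminantBounds

/-! ### Lower bounds for height and volume of an element -/

section ElementBounds

variable {d : ℕ} {γ m₀ m₁ α B r₀ N aHat hHat : ℝ}

/-- The right-hand side of the lower bound for the height as a single power. -/
theorem height_bound_eq (hd : 0 < d) (hγ : 1 < γ) (hm₁ : 0 < m₁) (hr₀ : 0 < r₀) (hN : 0 < N)
    {Y : ℝ} (hY : 0 ≤ Y) :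
    Y ^ (1 / ((d : ℝ) * γ - d)) * r₀ ^ (γ / (γ - 1)) * m₁ ^ (-(1 / (2 * (γ - 1)))) *
      N ^ (-(γ / ((d : ℝ) * γ - d))) =
    (Y * (r₀ * N ^ (-(1 / (d : ℝ)))) ^ ((d : ℝ) * γ) * m₁ ^ (-((d : ℝ) / 2))) ^
      (1 / ((d : ℝ) * γ - d)) := by
  have hD : (0 : ℝ) < d := by exact_mod_cast hd
  have hγ1 : γ - 1 ≠ 0 := by linarith
  have he : (d : ℝ) * γ - d = d * (γ - 1) := by ring
  rw [Real.mul_rpow (by positivity) (by positivity), Real.mul_rpow hY (by positivity),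
    Real.mul_rpow hr₀.le (by positivity), Real.mul_rpow (by positivity) (by positivity),
    ← Real.rpow_mul hr₀.le, ← Real.rpow_mul hN.le, ← Real.rpow_mul hN.le, ← Real.rpow_mul hm₁.le]
  have e1 : (d : ℝ) * γ * (1 / ((d : ℝ) * γ - d)) = γ / (γ - 1) := by
    rw [he]; field_simp
  have e2 : -(1 / (d : ℝ)) * ((d : ℝ) * γ) * (1 / ((d : ℝ) * γ - d)) =
      -(γ / ((d : ℝ) * γ - d)) := by
    rw [he]; field_simp
  have e3 : -((d : ℝ) / 2) * (1 / ((d : ℝ) * γ - d)) = -(1 / (2 * (γ - 1))) := by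
    rw [he]; field_simp
  rw [e1, e2, e3]
  ring

theorem volume_bound_eq (hd : 0 < d) (hγ : 1 < γ) (hm₁ : 0 < m₁) (hr₀ : 0 < r₀) (hN : 0 < N)
    {C : ℝ} :
    C ^ d / (d.factorial : ℝ) * r₀ ^ ((d : ℝ) * γ / (γ - 1)) *
      m₁ ^ (-((d : ℝ) / (2 * (γ - 1))) - (d : ℝ) / 2) * N ^ (-(γ / (γ - 1))) =
    (C * r₀ ^ (γ / (γ - 1)) * m₁ ^ (-(1 / (2 * (γ - 1)))) *
      N ^ (-(γ / ((d : ℝ) * γ - d)))) ^ d * m₁ ^ (-((d : ℝ) / 2)) / d.factorial := by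
  have hD : (0 : ℝ) < d := by exact_mod_cast hd
  have hγ1 : γ - 1 ≠ 0 := by linarith
  have he : (d : ℝ) * γ - d = d * (γ - 1) := by ring
  simp only [mul_pow]
  rw [← Real.rpow_natCast (r₀ ^ _), ← Real.rpow_natCast (m₁ ^ _), ← Real.rpow_natCast (N ^ _),
    ← Real.rpow_mul hr₀.le, ← Real.rpow_mul hm₁.le, ← Real.rpow_mul hN.le]
  have e1 : γ / (γ - 1) * (d : ℝ) = (d : ℝ) * γ / (γ - 1) := by ring
  have e2 : -(γ / ((d : ℝ) * γ - d)) * (d : ℝ) = -(γ / (γ - 1)) := by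
    rw [he]; field_simp
  have e3 : m₁ ^ (-((d : ℝ) / (2 * (γ - 1))) - (d : ℝ) / 2) =
      m₁ ^ (-(1 / (2 * (γ - 1))) * (d : ℝ)) * m₁ ^ (-((d : ℝ) / 2)) := by
    rw [← Real.rpow_add hm₁]
    congr 1
    ring
  rw [e1, e2, e3]
  ring

/-- With `r ≤ √τ a`, split `a^(dγ) = a^(dγ-d) a^d` and estimate `a^d` by the volume. The product
`|K| τ^(dγ/2)` then appears, which the hypothesis bounds. The reference simplex contributes only the
factor `(â/ĥ)^(dγ) ≤ 1`, which weakens the estimate. -/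
theorem element_bounds (hd : 0 < d) (hγ : 1 < γ) (hm₀ : 0 < m₀) (hα : 0 < α) (hr₀ : 0 < r₀)
    (hN : 0 < N) (haHat : 0 ≤ aHat) (hhHat : 0 < hHat) (hah : aHat ≤ hHat)
    {p q : Fin (d + 1) → Space d} (hp : (edgeMatrix p).det ≠ 0) (hq : (edgeMatrix q).det ≠ 0)
    {M : Matrix (Fin d) (Fin d) ℝ} (hM : MetricBounds m₀ m₁ M)
    (h : α * (simplexVolume p * (pullback (edgeMatrix p * (edgeMatrix q)⁻¹) M).trace ^
      ((d : ℝ) * γ / 2)) ≤ B)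
    (hr : r₀ * N ^ (-(1 / (d : ℝ))) ≤ inDiameter q) {C : ℝ}
    (hC : C = (α * aHat ^ ((d : ℝ) * γ) / ((d.factorial : ℝ) * hHat ^ ((d : ℝ) * γ) * B)) ^
      (1 / ((d : ℝ) * γ - d))) :
    C * r₀ ^ (γ / (γ - 1)) * m₁ ^ (-(1 / (2 * (γ - 1)))) * N ^ (-(γ / ((d : ℝ) * γ - d))) ≤
      minHeight M p ∧
    C ^ d / (d.factorial : ℝ) * r₀ ^ ((d : ℝ) * γ / (γ - 1)) *
      m₁ ^ (-((d : ℝ) / (2 * (γ - 1))) - (d : ℝ) / 2) * N ^ (-(γ / (γ - 1))) ≤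
      simplexVolume p := by
  have : Nonempty (Fin d) := ⟨⟨0, hd⟩⟩
  have hD : (0 : ℝ) < d := by exact_mod_cast hd
  have hm₁ : 0 < m₁ := hm₀.trans_le (hM.le hd)
  have hMpos := hM.posDef hm₀
  have he : 0 < (d : ℝ) * γ - d := by nlinarith
  have hJ : (edgeMatrix p * (edgeMatrix q)⁻¹).det ≠ 0 := by
    rw [det_mul, det_nonsing_inv, Ring.inverse_eq_inv']
    exact mul_ne_zero hp (inv_ne_zero hq)
  have hin := inDiameter_le_sqrt_trace_mul_minHeight hd hp hq hMpos
  have htr := (pullback_posDef hJ hMpos).trace_pos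
  set τ := (pullback (edgeMatrix p * (edgeMatrix q)⁻¹) M).trace with hτ
  set a := minHeight M p with ha
  set r := r₀ * N ^ (-(1 / (d : ℝ))) with hrdef
  have hr0 : 0 < r := by positivity
  have ha0 : 0 < a := by
    refine lt_of_le_of_ne (minHeight_nonneg _ _) fun h0 => ?_
    rw [← h0, mul_zero] at hin
    linarith
  have hfac : (0 : ℝ) < d.factorial := by exact_mod_cast d.factorial_pos
  have hvpos := simplexVolume_pos hp
  have hB : 0 < B := lt_of_lt_of_le (by positivity) h
  have hvol : a ^ d * m₁ ^ (-((d : ℝ) / 2)) / d.factorial ≤ simplexVolume p := by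
    have h1 := minHeight_pow_le hd hp hMpos
    have h2 : Real.sqrt M.det ≤ m₁ ^ ((d : ℝ) / 2) := by
      refine (Real.sqrt_le_sqrt (hM.det_le hm₀ hd)).trans_eq ?_
      rw [Real.sqrt_eq_rpow, ← Real.rpow_natCast, ← Real.rpow_mul hm₁.le]
      congr 1
      ring
    rw [simplexVolume, Real.rpow_neg hm₁.le, ← div_eq_mul_inv]
    refine div_le_div_of_nonneg_right ?_ hfac.le
    rw [div_le_iff₀ (by positivity)]
    exact h1.trans (mul_le_mul_of_nonneg_left h2 (abs_nonneg _))
  have hrpow : r ^ ((d : ℝ) * γ) ≤ τ ^ ((d : ℝ) * γ / 2) * a ^ ((d : ℝ) * γ) := by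
    have h1 := Real.rpow_le_rpow hr0.le (hr.trans hin) (by positivity : 0 ≤ (d : ℝ) * γ)
    rw [Real.mul_rpow (Real.sqrt_nonneg _) ha0.le, Real.sqrt_eq_rpow, ← Real.rpow_mul htr.le]
      at h1
    rwa [show 1 / 2 * ((d : ℝ) * γ) = (d : ℝ) * γ / 2 by ring] at h1
  have hsplit : a ^ ((d : ℝ) * γ) = a ^ ((d : ℝ) * γ - d) * a ^ d := by
    rw [← Real.rpow_natCast a d, ← Real.rpow_add ha0]
    congr 1
    ring
  have hkey : α / d.factorial * r ^ ((d : ℝ) * γ) * m₁ ^ (-((d : ℝ) / 2)) ≤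
      B * a ^ ((d : ℝ) * γ - d) := by
    have hm : 0 < m₁ ^ (-((d : ℝ) / 2)) := by positivity
    have hτp : 0 < τ ^ ((d : ℝ) * γ / 2) := by positivity
    have hap : 0 < a ^ ((d : ℝ) * γ - d) := by positivity
    calc α / d.factorial * r ^ ((d : ℝ) * γ) * m₁ ^ (-((d : ℝ) / 2))
        ≤ α / d.factorial * (τ ^ ((d : ℝ) * γ / 2) * a ^ ((d : ℝ) * γ)) *
          m₁ ^ (-((d : ℝ) / 2)) := by gcongr
      _ = α * ((a ^ d * m₁ ^ (-((d : ℝ) / 2)) / d.factorial) * τ ^ ((d : ℝ) * γ / 2)) *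
          a ^ ((d : ℝ) * γ - d) := by rw [hsplit]; ring
      _ ≤ α * (simplexVolume p * τ ^ ((d : ℝ) * γ / 2)) * a ^ ((d : ℝ) * γ - d) := by gcongr
      _ ≤ B * a ^ ((d : ℝ) * γ - d) := by gcongr
  have hratio : α * aHat ^ ((d : ℝ) * γ) / ((d.factorial : ℝ) * hHat ^ ((d : ℝ) * γ) * B) ≤
      α / (d.factorial * B) := by
    have h1 : aHat ^ ((d : ℝ) * γ) ≤ hHat ^ ((d : ℝ) * γ) :=
      Real.rpow_le_rpow haHat hah (by positivity)
    have h2 : 0 < hHat ^ ((d : ℝ) * γ) := by positivity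
    rw [div_le_div_iff₀ (by positivity) (by positivity)]
    calc α * aHat ^ ((d : ℝ) * γ) * (d.factorial * B) ≤
        α * hHat ^ ((d : ℝ) * γ) * (d.factorial * B) := by gcongr
      _ = _ := by ring
  have hY : 0 ≤ α * aHat ^ ((d : ℝ) * γ) /
      ((d.factorial : ℝ) * hHat ^ ((d : ℝ) * γ) * B) := by positivity
  have hfirst : C * r₀ ^ (γ / (γ - 1)) * m₁ ^ (-(1 / (2 * (γ - 1)))) *
      N ^ (-(γ / ((d : ℝ) * γ - d))) ≤ a := by
    rw [hC, height_bound_eq hd hγ hm₁ hr₀ hN hY, ← hrdef, one_div,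
      Real.rpow_inv_le_iff_of_pos (by positivity) ha0.le he]
    calc _ ≤ α / (d.factorial * B) * r ^ ((d : ℝ) * γ) * m₁ ^ (-((d : ℝ) / 2)) := by gcongr
      _ = (α / d.factorial * r ^ ((d : ℝ) * γ) * m₁ ^ (-((d : ℝ) / 2))) / B := by
        field_simp
      _ ≤ _ := by
        rw [div_le_iff₀ hB, mul_comm _ B]
        exact hkey
  refine ⟨hfirst, ?_⟩
  rw [volume_bound_eq hd hγ hm₁ hr₀ hN]
  refine le_trans ?_ hvol
  have hC0 : 0 ≤ C := by rw [hC]; positivity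
  gcongr

end ElementBounds

/-! ### The determinant formula against Lebesgue measure -/

section SimplexMeasure

/-- The corner simplex spanned by the origin and the unit vectors. -/
def cornerSimplex (d : ℕ) : Set (Fin d → ℝ) := {y | (∀ i, 0 ≤ y i) ∧ ∑ i, y i ≤ 1}

/-- The points of the unit cube with increasing coordinates. -/
def orderedCube (d : ℕ) : Set (Fin d → ℝ) := {x | (∀ i, 0 ≤ x i ∧ x i ≤ 1) ∧ Monotone x}

/-- The matrix of partial sums. -/
def partialSumMatrix (d : ℕ) : Matrix (Fin d) (Fin d) ℝ :=
  Matrix.of fun i j => if j ≤ i then 1 else 0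

theorem partialSumMatrix_det (d : ℕ) : (partialSumMatrix d).det = 1 := by
  rw [det_of_isLowerTriangular]
  · simp [partialSumMatrix]
  · intro i j hij
    have : i < j := hij
    simp [partialSumMatrix, not_le.2 this]

theorem orderedCube_subset (d : ℕ) :
    orderedCube d ⊆ Matrix.toLin' (partialSumMatrix d) '' cornerSimplex d := by
  rintro x ⟨hx, hmono⟩
  -- The coordinates of `x` shifted by one, with `f 0 = 0`; the increments of `f` form the preimage
  -- of `x`, and their partial sums telescope.
  set f : ℕ → ℝ := fun k => if h : k - 1 < d ∧ 0 < k then x ⟨k - 1, h.1⟩ else 0 with hf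
  have hf0 : f 0 = 0 := by simp [hf]
  have hfs : ∀ k (h : k < d), f (k + 1) = x ⟨k, h⟩ := by
    intro k h
    simp [hf, h]
  have hstep : ∀ k : Fin d, f k ≤ f (k + 1) := by
    rintro ⟨k, hk⟩
    rw [hfs k hk]
    rcases k with _ | k
    · exact hf0.trans_le (hx _).1
    · rw [hfs k (by omega)]
      exact hmono (Fin.mk_le_mk.2 (by omega))
  have hsum : ∀ m ≤ d, ∑ k : Fin d, (if (k : ℕ) < m then f (k + 1) - f k else 0) = f m := by
    intro m hm
    rw [Fin.sum_univ_eq_sum_range (fun k => if k < m then f (k + 1) - f k else 0) d,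
      ← Finset.sum_filter]
    have : (Finset.range d).filter (fun k => k < m) = Finset.range m := by
      ext k
      simp only [Finset.mem_filter, Finset.mem_range]
      omega
    rw [this, Finset.sum_range_sub, hf0, sub_zero]
  refine ⟨fun k => f (k + 1) - f k, ⟨fun k => sub_nonneg.2 (hstep k), ?_⟩, ?_⟩
  · have h1 := hsum d le_rfl
    simp only [Fin.is_lt, if_true] at h1
    rw [h1]
    rcases d with _ | d
    · rw [hf0]
      exact zero_le_one
    · rw [hfs d (by omega)]
      exact (hx _).2
  · ext i
    rw [toLin'_apply, mulVec, dotProduct]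
    have h1 := hsum (i + 1) i.2
    rw [hfs i i.2] at h1
    rw [← h1]
    refine Finset.sum_congr rfl fun k _ => ?_
    simp only [partialSumMatrix, of_apply, Fin.le_def, ite_mul, one_mul, zero_mul,
      Nat.lt_succ_iff]

theorem volume_orderedCube_le (d : ℕ) : volume (orderedCube d) ≤ volume (cornerSimplex d) := by
  refine (measure_mono (orderedCube_subset d)).trans ?_
  rw [Measure.addHaar_image_linearMap, LinearMap.det_toLin', partialSumMatrix_det]
  simp

/-- Sorting coordinates covers the unit cube by `d!` permuted copies of the ordered cube, which has
at most the volume of the corner simplex. -/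
theorem one_le_factorial_mul_volume_cornerSimplex (d : ℕ) :
    1 ≤ (d.factorial : ENNReal) * volume (cornerSimplex d) := by
  have hcube : volume (Set.Icc (0 : Fin d → ℝ) 1) = 1 := by
    rw [Real.volume_Icc_pi]
    simp
  have hcover : Set.Icc (0 : Fin d → ℝ) 1 ⊆
      ⋃ σ : Equiv.Perm (Fin d), (fun x => x ∘ σ) ⁻¹' orderedCube d := by
    intro x hx
    refine Set.mem_iUnion.2 ⟨Tuple.sort x, fun i => ⟨hx.1 _, hx.2 _⟩, Tuple.monotone_sort x⟩
  have hvol : ∀ σ : Equiv.Perm (Fin d),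
      volume ((fun x : Fin d → ℝ => x ∘ σ) ⁻¹' orderedCube d) = volume (orderedCube d) := by
    intro σ
    exact (measurePreserving_arrowCongr' (fun _ => volume) (fun _ => volume) σ.symm
      (MeasurableEquiv.refl ℝ) fun _ => MeasurePreserving.id _).measure_preimage_equiv _
  calc (1 : ENNReal) = volume (Set.Icc (0 : Fin d → ℝ) 1) := hcube.symm
    _ ≤ ∑ σ : Equiv.Perm (Fin d), volume ((fun x : Fin d → ℝ => x ∘ σ) ⁻¹' orderedCube d) :=
      (measure_mono hcover).trans (measure_iUnion_fintype_le _ _)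
    _ = d.factorial * volume (orderedCube d) := by
      simp only [hvol, Finset.sum_const, Finset.card_univ, Fintype.card_perm, Fintype.card_fin,
        nsmul_eq_mul]
    _ ≤ _ := mul_le_mul_right (volume_orderedCube_le d) _

variable {d : ℕ}

theorem mem_simplex_of_mem_cornerSimplex (p : Fin (d + 1) → Space d) {y : Fin d → ℝ}
    (hy : y ∈ cornerSimplex d) : WithLp.toLp 2 (edgeMatrix p *ᵥ y) + p 0 ∈ simplex p := by
  have h1 : WithLp.toLp 2 (edgeMatrix p *ᵥ y) + p 0 =
      ∑ k, (Fin.cons (1 - ∑ i, y i) y : Fin (d + 1) → ℝ) k • p k := by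
    rw [edgeMatrix_mulVec, Fin.sum_univ_succ, WithLp.toLp_ofLp]
    simp only [Fin.cons_zero, Fin.cons_succ, smul_sub, Finset.sum_sub_distrib, sub_smul, one_smul,
      ← Finset.sum_smul]
    abel
  rw [h1]
  refine (convex_convexHull ℝ _).sum_mem ?_ ?_ fun k _ => subset_convexHull ℝ _ ⟨k, rfl⟩
  · intro k _
    refine Fin.cases ?_ (fun k => ?_) k
    · simpa using hy.2
    · simpa using hy.1 k
  · rw [Fin.sum_univ_succ]
    simp

/-- This one inequality is enough, since the total of the volumes is only needed from above. -/
theorem ofReal_simplexVolume_le (p : Fin (d + 1) → Space d) :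
    ENNReal.ofReal (simplexVolume p) ≤ volume (simplex p) := by
  have h1 : volume (simplex p) = volume ((WithLp.toLp 2 : (Fin d → ℝ) → Space d) ⁻¹' simplex p) :=
    ((EuclideanSpace.volume_preserving_symm_measurableEquiv_toLp (Fin d)).symm
      |>.measure_preimage_equiv _).symm
  have h2 : (fun z => z + (p 0).ofLp) '' (Matrix.toLin' (edgeMatrix p) '' cornerSimplex d) ⊆
      (WithLp.toLp 2 : (Fin d → ℝ) → Space d) ⁻¹' simplex p := by
    rintro _ ⟨_, ⟨y, hy, rfl⟩, rfl⟩
    exact mem_simplex_of_mem_cornerSimplex p hy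
  rw [h1]
  refine le_trans ?_ (measure_mono h2)
  rw [Set.image_add_right, measure_preimage_add_right, Measure.addHaar_image_linearMap,
    LinearMap.det_toLin', simplexVolume, ENNReal.ofReal_div_of_pos
      (by exact_mod_cast d.factorial_pos), ENNReal.ofReal_natCast]
  refine ENNReal.div_le_of_le_mul ?_
  rw [mul_assoc, mul_comm (volume _)]
  exact le_mul_of_one_le_right zero_le (one_le_factorial_mul_volume_cornerSimplex d)

theorem ofReal_simplexVolume_le_interior (p : Fin (d + 1) → Space d) :
    ENNReal.ofReal (simplexVolume p) ≤ volume (interior (simplex p)) := by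
  refine (ofReal_simplexVolume_le p).trans ?_
  refine (measure_mono (subset_closure.trans
    (closure_eq_interior_union_frontier (simplex p)).subset)).trans ?_
  refine (measure_union_le _ _).trans ?_
  have h : volume (frontier (simplex p)) = 0 := (convex_convexHull ℝ _).addHaar_frontier volume
  rw [h, add_zero]

end SimplexMeasure

/-! ### The total volume of a conforming mesh -/

section MeshMeasure

variable {d : ℕ} {V Elt : Type*} {conn : Elt → Fin (d + 1) → V} {x : V → Space d}
  {Ω : Set (Space d)}

theorem IsMeshOf.conn_injective (h : IsMeshOf conn x Ω) (K : Elt) :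
    Function.Injective (conn K) :=
  Function.Injective.of_comp (f := x) (h.nondegenerate K).injective

theorem IsMeshOf.not_range_subset (h : IsMeshOf conn x Ω) {K K' : Elt} (hK : K ≠ K') :
    ¬ Set.range (conn K) ⊆ Set.range (conn K') := by
  intro hsub
  refine h.distinct K K' hK (Set.eq_of_subset_of_ncard_le hsub ?_ (Set.finite_range _))
  rw [← Set.image_univ, ← Set.image_univ, Set.ncard_image_of_injective _ (h.conn_injective K),
    Set.ncard_image_of_injective _ (h.conn_injective K')]

theorem interior_simplex_eq {p : Fin (d + 1) → Space d} (hp : AffineIndependent ℝ p) :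
    interior (simplex p) = {y | ∀ j, 0 < (simplexBasis p hp).coord j y} :=
  (simplexBasis p hp).interior_convexHull

theorem interior_simplex_nonempty {p : Fin (d + 1) → Space d} (hp : AffineIndependent ℝ p) :
    (interior (simplex p)).Nonempty :=
  ⟨_, (simplexBasis p hp).centroid_mem_interior_convexHull⟩

/-- By conformity a common point lies in a face that misses some vertex of `K`. The barycentric
coordinate of that vertex vanishes there but is positive in the interior. -/
theorem IsMeshOf.disjoint_interior (h : IsMeshOf conn x Ω) {K K' : Elt} (hK : K ≠ K') :
    Disjoint (interior (simplex (elementVertices conn x K)))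
      (interior (simplex (elementVertices conn x K'))) := by
  rw [Set.disjoint_left]
  intro y hy hy'
  obtain ⟨_, ⟨j, rfl⟩, hj⟩ := Set.not_subset.1 (h.not_range_subset hK)
  have hmem : y ∈ convexHull ℝ (x '' (Set.range (conn K) ∩ Set.range (conn K'))) := by
    rw [← h.conforming K K' hK]
    exact ⟨_root_.interior_subset hy, _root_.interior_subset hy'⟩
  have hsub : x '' (Set.range (conn K) ∩ Set.range (conn K')) ⊆
      elementVertices conn x K '' {j}ᶜ := by
    rintro _ ⟨_, ⟨⟨k, rfl⟩, hk⟩, rfl⟩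
    refine ⟨k, ?_, rfl⟩
    rintro rfl
    exact hj hk
  have h0 := coord_eq_zero_of_mem_facet (h.nondegenerate K)
    (convexHull_subset_affineSpan _ (convexHull_mono hsub hmem))
  rw [interior_simplex_eq (h.nondegenerate K)] at hy
  exact (hy j).ne' h0

theorem IsMeshOf.nonempty [Nonempty Elt] (h : IsMeshOf conn x Ω) : Ω.Nonempty := by
  obtain ⟨K⟩ := ‹Nonempty Elt›
  exact (interior_simplex_nonempty (h.nondegenerate K)).mono (h.interior_subset K)

theorem IsMeshOf.vertex_mem_closure (h : IsMeshOf conn x Ω) (K : Elt) (j : Fin (d + 1)) :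
    x (conn K j) ∈ closure Ω := by
  rw [← h.union_eq]
  exact Set.mem_iUnion.2 ⟨K, subset_convexHull ℝ _ ⟨j, rfl⟩⟩

variable [Fintype Elt]

theorem IsMeshOf.isCompact_closure (h : IsMeshOf conn x Ω) : IsCompact (closure Ω) := by
  rw [← h.union_eq]
  exact isCompact_iUnion fun K => (Set.finite_range _).isCompact_convexHull ℝ

theorem IsMeshOf.sum_simplexVolume_le (h : IsMeshOf conn x Ω) :
    ∑ K, simplexVolume (elementVertices conn x K) ≤ volume.real Ω := by
  have hfin : volume Ω ≠ ⊤ :=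
    ((measure_mono subset_closure).trans_lt h.isCompact_closure.measure_lt_top).ne
  rw [measureReal_def, ← ENNReal.ofReal_le_iff_le_toReal hfin,
    ENNReal.ofReal_sum_of_nonneg fun K _ => simplexVolume_nonneg _]
  calc _ ≤ ∑ K, volume (interior (simplex (elementVertices conn x K))) :=
        Finset.sum_le_sum fun K _ => ofReal_simplexVolume_le_interior _
    _ = volume (⋃ K, interior (simplex (elementVertices conn x K))) := by
      rw [measure_iUnion (fun K K' hK => h.disjoint_interior hK)
        fun K => isOpen_interior.measurableSet, tsum_fintype]
    _ ≤ volume Ω := measure_mono (Set.iUnion_subset h.interior_subset)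

end MeshMeasure

/-! ### Variation of the signed volume with one vertex -/

section BarycentricMatrix

variable {d : ℕ}

/-- The row `(c, v)` of a barycentric matrix. -/
def homogeneousRow (c : ℝ) (v : Space d) : Fin (d + 1) → ℝ := Fin.cons c v.ofLp

/-- The matrix with the rows `(1, p j)`. -/
def barycentricMatrix (p : Fin (d + 1) → Space d) : Matrix (Fin (d + 1)) (Fin (d + 1)) ℝ :=
  Matrix.of fun j => homogeneousRow 1 (p j)

/-- The derivative of the signed volume, up to the factor `d!`, with respect to the vertex `j` in
the direction `v`. -/
noncomputable def facetForm (p : Fin (d + 1) → Space d) (j : Fin (d + 1)) (v : Space d) : ℝ :=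
  ((barycentricMatrix p).updateRow j (homogeneousRow 0 v)).det

/-- The edge matrix singles out vertex `0`; the barycentric matrix treats all vertices alike, so
each vertex motion changes one row. Subtracting the first row and expanding along the first column
compares the two. -/
theorem barycentricMatrix_det (p : Fin (d + 1) → Space d) :
    (barycentricMatrix p).det = (edgeMatrix p).det := by
  set B : Matrix (Fin (d + 1)) (Fin (d + 1)) ℝ :=
    Matrix.of (Fin.cons (homogeneousRow 1 (p 0))
      fun k : Fin d => homogeneousRow 0 (p k.succ - p 0)) with hB
  have h1 : (barycentricMatrix p).det = B.det := by
    refine det_eq_of_forall_row_eq_smul_add_const (Fin.cons 0 fun _ => 1) 0 rfl ?_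
    intro i j
    refine Fin.cases ?_ (fun i => ?_) i
    · simp [hB, barycentricMatrix]
    · refine Fin.cases ?_ (fun j => ?_) j
      · simp [hB, barycentricMatrix, homogeneousRow]
      · simp [hB, barycentricMatrix, homogeneousRow]
  rw [h1, det_succ_column_zero, Fin.sum_univ_succ]
  have h2 : B.submatrix (Fin.succAbove 0) Fin.succ = (edgeMatrix p)ᵀ := by
    ext i j
    simp [hB, edgeMatrix, homogeneousRow]
  rw [h2, det_transpose]
  simp [hB, homogeneousRow]

theorem barycentricMatrix_update (p : Fin (d + 1) → Space d) (j : Fin (d + 1)) (z : Space d) :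
    barycentricMatrix (Function.update p j z) =
      (barycentricMatrix p).updateRow j (homogeneousRow 1 z) := by
  ext k l
  rw [updateRow_apply]
  split_ifs with h
  · subst h
    simp [barycentricMatrix]
  · simp [barycentricMatrix, h]

theorem edgeMatrix_det_update_add (p : Fin (d + 1) → Space d) (j : Fin (d + 1)) (v : Space d) :
    (edgeMatrix (Function.update p j (p j + v))).det = (edgeMatrix p).det + facetForm p j v := by
  rw [← barycentricMatrix_det, ← barycentricMatrix_det, barycentricMatrix_update]
  have : homogeneousRow 1 (p j + v) = barycentricMatrix p j + homogeneousRow 0 v := by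
    ext k
    refine Fin.cases ?_ (fun k => ?_) k <;> simp [homogeneousRow, barycentricMatrix]
  rw [this, det_updateRow_add, updateRow_eq_self, facetForm]

theorem facetForm_update (p : Fin (d + 1) → Space d) (j : Fin (d + 1)) (z v : Space d) :
    facetForm (Function.update p j z) j v = facetForm p j v := by
  rw [facetForm, barycentricMatrix_update, updateRow_idem, facetForm]

/-- The form opposite to `j` depends only on the facet, so that two elements sharing the facet can
be compared. -/
theorem facetForm_congr {p q : Fin (d + 1) → Space d} {j : Fin (d + 1)}
    (h : ∀ k, k ≠ j → p k = q k) (v : Space d) : facetForm p j v = facetForm q j v := by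
  have : q = Function.update p j (q j) := by
    ext1 k
    by_cases hk : k = j
    · subst hk; simp
    · rw [Function.update_of_ne hk, h k hk]
  rw [this, facetForm_update]

/-- A translation does not change the volume. -/
theorem sum_facetForm (p : Fin (d + 1) → Space d) (v : Space d) :
    ∑ j, facetForm p j v = 0 := by
  set A := barycentricMatrix p with hA
  have h1 : ∀ j, facetForm p j v = ∑ c, homogeneousRow 0 v c * A.adjugate c j := by
    intro j
    rw [facetForm, ← cramer_transpose_apply, cramer_eq_adjugate_mulVec, ← adjugate_transpose,
      mulVec_transpose]
    rfl
  -- The first column of `A` consists of ones, so the row sums of the adjugate are `det A` in row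
  -- `0` and zero elsewhere; the row `(0, v)` does not see the former.
  have h2 : A *ᵥ Pi.single 0 1 = fun _ => 1 := by
    rw [mulVec_single_one]
    ext j
    simp [hA, barycentricMatrix, homogeneousRow, col_apply]
  have h3 : A.adjugate *ᵥ (fun _ => 1) = A.det • Pi.single 0 1 := by
    rw [← h2, mulVec_mulVec, adjugate_mul, smul_mulVec, one_mulVec]
  simp only [h1]
  rw [Finset.sum_comm]
  simp only [← Finset.mul_sum]
  have h4 : ∀ c, ∑ j, A.adjugate c j = (A.det • (Pi.single 0 1 : Fin (d + 1) → ℝ)) c := by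
    intro c
    rw [← h3, mulVec, dotProduct]
    simp
  simp only [h4]
  rw [Fin.sum_univ_succ]
  simp [homogeneousRow]

theorem edgeMatrix_det_comp (p : Fin (d + 1) → Space d) (σ : Equiv.Perm (Fin (d + 1))) :
    (edgeMatrix (p ∘ σ)).det = Equiv.Perm.sign σ * (edgeMatrix p).det := by
  rw [← barycentricMatrix_det, ← barycentricMatrix_det, ← det_permute]
  rfl

theorem facetForm_comp (p : Fin (d + 1) → Space d) (σ : Equiv.Perm (Fin (d + 1)))
    (j : Fin (d + 1)) (v : Space d) :
    facetForm (p ∘ σ) j v = Equiv.Perm.sign σ * facetForm p (σ j) v := by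
  have h1 := edgeMatrix_det_update_add (p ∘ σ) j v
  have h2 := edgeMatrix_det_update_add p (σ j) v
  have h3 : Function.update (p ∘ σ) j ((p ∘ σ) j + v) =
      Function.update p (σ j) (p (σ j) + v) ∘ σ := by
    rw [Function.update_comp_eq_of_injective _ σ.injective]
    rfl
  rw [h3, edgeMatrix_det_comp, edgeMatrix_det_comp, h2] at h1
  linarith

/-- The row of `z` is the barycentric combination of all rows, of which only the row `j` survives in
the determinant. Thus the sign of the coordinate tells on which side of the facet `z` lies. -/
theorem edgeMatrix_det_update {p : Fin (d + 1) → Space d} (hp : AffineIndependent ℝ p)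
    (j : Fin (d + 1)) (z : Space d) :
    (edgeMatrix (Function.update p j z)).det =
      (simplexBasis p hp).coord j z * (edgeMatrix p).det := by
  rw [← barycentricMatrix_det, ← barycentricMatrix_det, barycentricMatrix_update]
  have h : homogeneousRow 1 z =
      ∑ k, (simplexBasis p hp).coord k z • barycentricMatrix p k := by
    have h1 := (simplexBasis p hp).sum_coord_apply_eq_one z
    have h2 := (simplexBasis p hp).linear_combination_coord_eq_self z
    ext a
    refine Fin.cases ?_ (fun a => ?_) a
    · simp [homogeneousRow, barycentricMatrix, h1]
    · have h3 := congrArg (fun w : Space d => w a) h2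
      simp only [simplexBasis_coe] at h3
      simp [homogeneousRow, barycentricMatrix]
      simpa using h3.symm
  rw [h, det_updateRow_sum, smul_eq_mul]

/-- The facet form vanishes on a subspace that contains the differences of the vertices of the
facet and the direction. -/
theorem facetForm_eq_zero (hd : 0 < d) {p : Fin (d + 1) → Space d} {j : Fin (d + 1)}
    {v : Space d} {ψ : Space d →ₗ[ℝ] ℝ} (hψ : ψ ≠ 0)
    (h : ∀ k k', k ≠ j → k' ≠ j → ψ (p k - p k') = 0) (hv : ψ v = 0) : facetForm p j v = 0 := by
  have : Nontrivial (Fin (d + 1)) := Fin.nontrivial_iff_two_le.2 (by omega)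
  obtain ⟨k₀, hk₀⟩ := exists_ne j
  have hexp : ∀ w : Space d, ∑ a, w a * ψ (EuclideanSpace.single a 1) = ψ w := by
    intro w
    conv_rhs => rw [← (EuclideanSpace.basisFun (Fin d) ℝ).sum_repr w]
    simp
  have hrow : ∀ c w, homogeneousRow c w ⬝ᵥ
      (Fin.cons (-ψ (p k₀)) fun a => ψ (EuclideanSpace.single a 1)) =
      -(c * ψ (p k₀)) + ψ w := by
    intro c w
    rw [dotProduct, Fin.sum_univ_succ, ← hexp w]
    simp [homogeneousRow]
  rw [facetForm, ← exists_mulVec_eq_zero_iff]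
  -- The kernel vector is the affine function `ψ(· - p k₀)`: it vanishes on the facet vertices, and
  -- its linear part vanishes on `v`.
  refine ⟨Fin.cons (-ψ (p k₀)) fun a => ψ (EuclideanSpace.single a 1), ?_, ?_⟩
  · intro h0
    refine hψ (LinearMap.ext fun w => ?_)
    rw [← hexp w]
    refine Finset.sum_eq_zero fun a _ => ?_
    have := congrFun h0 a.succ
    simp only [Fin.cons_succ, Pi.zero_apply] at this
    rw [this, mul_zero]
  · ext k
    rw [mulVec]
    by_cases hk : k = j
    · subst hk
      rw [updateRow_self, hrow, hv]
      simp
    · rw [updateRow_ne hk]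
      change homogeneousRow 1 (p k) ⬝ᵥ _ = 0
      rw [hrow]
      have := h k k₀ hk hk₀
      rw [map_sub] at this
      linarith

end BarycentricMatrix

/-! ### Overlap of simplices on the same side of a facet -/

section OppositeSides

variable {d : ℕ}

/-- Two simplices on the same side of a common facet meet outside of the hyperplane of the
facet. -/
theorem exists_mem_inter_of_coord_pos (hd : 0 < d) {p : Fin (d + 1) → Space d}
    (hp : AffineIndependent ℝ p) {j : Fin (d + 1)} {z : Space d}
    (hz : 0 < (simplexBasis p hp).coord j z) :
    ∃ y ∈ simplex p ∩ simplex (Function.update p j z), (simplexBasis p hp).coord j y ≠ 0 := by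
  set b := simplexBasis p hp with hb
  have hD : (0 : ℝ) < d := by exact_mod_cast hd
  have hcard : (Finset.univ.erase j).card = d := by
    rw [Finset.card_erase_of_mem (Finset.mem_univ j)]
    simp
  have hw : ∑ k ∈ Finset.univ.erase j, (fun _ : Fin (d + 1) => (d : ℝ)⁻¹) k = 1 := by
    rw [Finset.sum_const, hcard, nsmul_eq_mul, mul_inv_cancel₀ hD.ne']
  -- The centroid of the facet; a short step from it towards `z` gives a point of both simplices off
  -- the facet.
  obtain ⟨g, hg⟩ : ∃ g, g = (Finset.univ.erase j).affineCombination ℝ b fun _ => (d : ℝ)⁻¹ :=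
    ⟨_, rfl⟩
  have hgj : b.coord j g = 0 := by
    rw [hg, b.coord_apply_combination_of_notMem (Finset.notMem_erase j _) hw]
  have hgk : ∀ k, k ≠ j → b.coord k g = (d : ℝ)⁻¹ := by
    intro k hk
    rw [hg, b.coord_apply_combination_of_mem (Finset.mem_erase.2 ⟨hk, Finset.mem_univ k⟩) hw]
  obtain ⟨c, hck⟩ : ∃ c, ∀ k, |b.coord k z| ≤ c :=
    ⟨∑ k, |b.coord k z|, fun k => Finset.single_le_sum (f := fun k => |b.coord k z|)
      (fun k _ => abs_nonneg _) (Finset.mem_univ k)⟩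
  have hc0 : 0 ≤ c := (abs_nonneg _).trans (hck j)
  -- Solves `(1 - s)/d = s c`: the facet coordinates `1/d` of the centroid, scaled by `1 - s`, then
  -- absorb negative coordinates of `z`, which are at least `-c`.
  set s := 1 / (1 + d * c) with hs
  have hs0 : 0 < s := by positivity
  have hs1 : 1 - s = d * c * s := by
    rw [hs]
    field_simp
    ring
  have hs2 : s ≤ 1 := by
    have : 0 ≤ d * c * s := by positivity
    linarith
  have hcoord : ∀ k, b.coord k (AffineMap.lineMap g z s) =
      (1 - s) * b.coord k g + s * b.coord k z := by
    intro k
    rw [AffineMap.apply_lineMap, AffineMap.lineMap_apply_ring]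
  refine ⟨AffineMap.lineMap g z s, ⟨?_, ?_⟩, ?_⟩
  · have : simplex p = {y | ∀ k, 0 ≤ b.coord k y} := b.convexHull_eq_nonneg_coord
    rw [this]
    intro k
    rw [hcoord]
    by_cases hk : k = j
    · subst hk
      rw [hgj]
      have := mul_pos hs0 hz
      linarith
    · rw [hgk k hk, hs1]
      have h1 : d * c * s * (d : ℝ)⁻¹ = s * c := by field_simp
      rw [h1]
      have h2 := neg_abs_le (b.coord k z)
      have h3 := hck k
      nlinarith
  · have hgm : g ∈ simplex (Function.update p j z) := by
      rw [hg, Finset.affineCombination_eq_linear_combination _ _ _ hw]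
      refine (convex_convexHull ℝ _).sum_mem (fun _ _ => by positivity) hw fun k hk =>
        subset_convexHull ℝ _ ⟨k, ?_⟩
      rw [Function.update_of_ne (Finset.ne_of_mem_erase hk), hb, simplexBasis_coe]
    refine (convex_convexHull ℝ _).lineMap_mem hgm (subset_convexHull ℝ _ ⟨j, by simp⟩)
      ⟨hs0.le, hs2⟩
  · rw [hcoord, hgj, mul_zero, zero_add]
    exact (mul_pos hs0 hz).ne'

end OppositeSides

/-! ### Facet cancellation and invariance of the total volume -/

section MeshCombinatorics

variable {d : ℕ} {V Elt : Type*} {conn : Elt → Fin (d + 1) → V} {x₀ : V → Space d}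
  {Ω : Set (Space d)}

/-- A common facet of two elements lets one enumerate their vertices in the same way, up to the
opposite vertex. -/
theorem exists_perm_of_facet_subset (hinj : ∀ K, Function.Injective (conn K)) {K K' : Elt}
    {j : Fin (d + 1)} (h : facet conn K j ⊆ Set.range (conn K')) :
    ∃ σ : Equiv.Perm (Fin (d + 1)), ∀ k, k ≠ j → conn K' (σ k) = conn K k := by
  have h1 : ∀ k, ∃ l, k ≠ j → conn K' l = conn K k := by
    intro k
    by_cases hk : k = j
    · exact ⟨k, fun h => absurd hk h⟩
    · obtain ⟨l, hl⟩ := h ⟨k, hk, rfl⟩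
      exact ⟨l, fun _ => hl⟩
  choose f hf using h1
  obtain ⟨g, hg⟩ := Finset.exists_equiv_extend_of_card_eq (α := Fin (d + 1))
    (t := (Finset.univ : Finset (Fin (d + 1)))) (by simp) (s := Finset.univ.erase j) (f := f)
    (Finset.subset_univ _) (by
      intro k hk l hl hkl
      apply hinj K
      rw [← hf k (Finset.ne_of_mem_erase hk), ← hf l (Finset.ne_of_mem_erase hl), hkl])
  refine ⟨g.trans (Equiv.subtypeUnivEquiv fun _ => Finset.mem_univ _), fun k hk => ?_⟩
  have := hg k (Finset.mem_erase.2 ⟨hk, Finset.mem_univ k⟩)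
  simp only [Equiv.trans_apply, Equiv.subtypeUnivEquiv_apply, this]
  exact hf k hk

theorem facet_eq_of_perm {K K' : Elt} {j : Fin (d + 1)} {σ : Equiv.Perm (Fin (d + 1))}
    (h : ∀ k, k ≠ j → conn K' (σ k) = conn K k) : facet conn K' (σ j) = facet conn K j := by
  ext v
  constructor
  · rintro ⟨k, hk, rfl⟩
    have hk' : σ.symm k ≠ j := fun h => hk (by rw [← h]; simp)
    exact ⟨σ.symm k, hk', by rw [← h _ hk', Equiv.apply_symm_apply]⟩
  · rintro ⟨k, hk, rfl⟩
    exact ⟨σ k, fun h => hk (σ.injective h), h k hk⟩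

theorem facet_injective (hinj : ∀ K, Function.Injective (conn K)) (K : Elt) :
    Function.Injective (facet conn K) := by
  intro j j' h
  by_contra hne
  have : conn K j ∈ facet conn K j := by
    rw [h]
    exact ⟨j, hne, rfl⟩
  obtain ⟨k, hk, hkj⟩ := this
  exact hk (hinj K hkj)

theorem facet_subset_range (K : Elt) (j : Fin (d + 1)) :
    facet conn K j ⊆ Set.range (conn K) :=
  Set.image_subset_range _ _

/-- Two elements with a common facet lie on opposite sides of it. -/
theorem IsMeshOf.det_mul_det_neg (hd : 0 < d) (h : IsMeshOf conn x₀ Ω) {K K' : Elt} (hK : K ≠ K')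
    {j : Fin (d + 1)} {σ : Equiv.Perm (Fin (d + 1))}
    (hσ : ∀ k, k ≠ j → conn K' (σ k) = conn K k) :
    (edgeMatrix (elementVertices conn x₀ K)).det *
      (edgeMatrix (elementVertices conn x₀ K' ∘ σ)).det < 0 := by
  set p := elementVertices conn x₀ K with hp
  have hpa : AffineIndependent ℝ p := h.nondegenerate K
  set z := x₀ (conn K' (σ j)) with hz
  have hq : elementVertices conn x₀ K' ∘ σ = Function.update p j z := by
    ext1 k
    by_cases hk : k = j
    · subst hk
      simp [hz, elementVertices]
    · rw [Function.update_of_ne hk, Function.comp_apply, elementVertices, hσ k hk]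
      rfl
  have hD : (edgeMatrix p).det ≠ 0 := (affineIndependent_iff_det_ne_zero p).1 hpa
  have hD' : (edgeMatrix (Function.update p j z)).det ≠ 0 := by
    rw [← affineIndependent_iff_det_ne_zero, ← hq]
    exact (h.nondegenerate K').comp_embedding σ.toEmbedding
  rw [hq]
  rw [edgeMatrix_det_update hpa] at hD' ⊢
  have hc0 : (simplexBasis p hpa).coord j z ≠ 0 := left_ne_zero_of_mul hD'
  have hc : (simplexBasis p hpa).coord j z < 0 := by
    -- On the same side, the elements would share a point off the hyperplane of the facet, whereas
    -- conformity confines the intersection to the facet.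
    refine lt_of_le_of_ne (not_lt.1 fun hpos => ?_) hc0
    obtain ⟨y, ⟨hy1, hy2⟩, hy⟩ := exists_mem_inter_of_coord_pos hd hpa hpos
    have hy3 : y ∈ simplex (elementVertices conn x₀ K') := by
      rwa [← hq, simplex, Set.range_comp, σ.range_eq_univ, Set.image_univ] at hy2
    have hmem : y ∈ convexHull ℝ (x₀ '' (Set.range (conn K) ∩ Set.range (conn K'))) := by
      rw [← h.conforming K K' hK]
      exact ⟨hy1, hy3⟩
    have hsub : x₀ '' (Set.range (conn K) ∩ Set.range (conn K')) ⊆ p '' {j}ᶜ := by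
      rintro _ ⟨_, ⟨⟨k, rfl⟩, hk⟩, rfl⟩
      refine ⟨k, ?_, rfl⟩
      rintro rfl
      refine h.not_range_subset hK ?_
      rintro _ ⟨l, rfl⟩
      by_cases hl : l = k
      · rwa [hl]
      · exact ⟨σ l, hσ l hl⟩
    exact hy (coord_eq_zero_of_mem_facet hpa
      (convexHull_subset_affineSpan _ (convexHull_mono hsub hmem)))
  have := mul_pos (neg_pos.2 hc) (sq_pos_of_ne_zero hD)
  nlinarith

/-- A facet belongs to at most two elements. -/
theorem IsMeshOf.eq_of_facet_subset (hd : 0 < d) (h : IsMeshOf conn x₀ Ω) {K K₁ K₂ : Elt}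
    {j : Fin (d + 1)} (h₁ : facet conn K j ⊆ Set.range (conn K₁)) (hK₁ : K₁ ≠ K)
    (h₂ : facet conn K j ⊆ Set.range (conn K₂)) (hK₂ : K₂ ≠ K) : K₁ = K₂ := by
  -- Three elements at one facet would lie pairwise on opposite sides of it, contradicting the signs
  -- of three determinants. The enumerations of `K₁` and `K₂` are matched through `K`.
  by_contra hne
  obtain ⟨σ, hσ⟩ := exists_perm_of_facet_subset h.conn_injective h₁
  obtain ⟨τ, hτ⟩ := exists_perm_of_facet_subset h.conn_injective h₂
  have e₁ := h.det_mul_det_neg hd hK₁.symm hσ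
  have e₂ := h.det_mul_det_neg hd hK₂.symm hτ
  have h12 : ∀ k, k ≠ σ j → conn K₂ ((σ.symm.trans τ) k) = conn K₁ k := by
    intro k hk
    have hk' : σ.symm k ≠ j := fun h => hk (by rw [← h]; simp)
    rw [Equiv.trans_apply, hτ _ hk', ← hσ _ hk', Equiv.apply_symm_apply]
  have e₃ := h.det_mul_det_neg hd hne h12
  have hcomp : elementVertices conn x₀ K₂ ∘ τ =
      (elementVertices conn x₀ K₂ ∘ (σ.symm.trans τ)) ∘ σ := by
    ext1 k
    simp
  rw [edgeMatrix_det_comp] at e₁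
  rw [hcomp, edgeMatrix_det_comp] at e₂
  set s : ℝ := ((Equiv.Perm.sign σ : ℤ) : ℝ)
  set a := (edgeMatrix (elementVertices conn x₀ K)).det
  set b := (edgeMatrix (elementVertices conn x₀ K₁)).det
  set c := (edgeMatrix (elementVertices conn x₀ K₂ ∘ (σ.symm.trans τ))).det
  have := mul_pos_of_neg_of_neg e₁ e₂
  have h5 : a * (s * b) * (a * (s * c)) = (a * s) ^ 2 * (b * c) := by ring
  rw [h5] at this
  nlinarith [mul_nonneg (sq_nonneg (a * s)) (neg_pos.2 e₃).le]

/-- The orientation of an element of a mesh. -/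
noncomputable def orientation (conn : Elt → Fin (d + 1) → V) (x₀ : V → Space d) (K : Elt) : ℝ :=
  (SignType.sign (edgeMatrix (elementVertices conn x₀ K)).det : ℝ)

theorem IsMeshOf.orientation_eq_neg (hd : 0 < d) (h : IsMeshOf conn x₀ Ω) {K K' : Elt}
    (hK : K ≠ K') {j : Fin (d + 1)} {σ : Equiv.Perm (Fin (d + 1))}
    (hσ : ∀ k, k ≠ j → conn K' (σ k) = conn K k) :
    orientation conn x₀ K = -(Equiv.Perm.sign σ * orientation conn x₀ K') := by
  have h1 := h.det_mul_det_neg hd hK hσ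
  rw [edgeMatrix_det_comp] at h1
  simp only [orientation]
  rcases Int.units_eq_one_or (Equiv.Perm.sign σ) with hs | hs <;> rw [hs] at h1 ⊢ <;>
    rcases mul_neg_iff.1 h1 with ⟨ha, hb⟩ | ⟨ha, hb⟩
  · simp at hb ⊢; simp [sign_pos ha, sign_neg hb]
  · simp at hb ⊢; simp [sign_neg ha, sign_pos hb]
  · simp at hb ⊢; simp [sign_pos ha, sign_pos hb]
  · simp at hb ⊢; simp [sign_neg ha, sign_neg hb]

theorem elementVertices_update_of_eq [DecidableEq V] (hinj : ∀ K, Function.Injective (conn K)) (x : V → Space d)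
    (K : Elt) (j : Fin (d + 1)) (z : Space d) :
    elementVertices conn (Function.update x (conn K j) z) K =
      Function.update (elementVertices conn x K) j z := by
  ext1 k
  by_cases hk : k = j
  · subst hk
    simp [elementVertices]
  · rw [Function.update_of_ne hk, elementVertices, Function.update_of_ne ((hinj K).ne hk)]
    rfl

theorem elementVertices_update_of_notMem [DecidableEq V] (x : V → Space d) {K : Elt} {i : V}
    (hi : i ∉ Set.range (conn K)) (z : Space d) :
    elementVertices conn (Function.update x i z) K = elementVertices conn x K := by
  ext1 k
  exact Function.update_of_ne (fun h => hi ⟨k, h⟩) _ _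

open Classical in
/-- The contribution of the facet `(K, j)` to the change of the total signed volume when the
vertex `i` moves in the direction `v`. -/
noncomputable def facetTerm (conn : Elt → Fin (d + 1) → V) (x₀ x : V → Space d) (i : V)
    (v : Space d) (a : Elt × Fin (d + 1)) : ℝ :=
  if i ∈ facet conn a.1 a.2 then
    orientation conn x₀ a.1 * facetForm (elementVertices conn x a.1) a.2 v else 0

/-- Renumbering the vertices multiplies the facet form by the sign of a permutation; the
orientations of opposite elements differ by minus that sign, so the terms cancel. -/
theorem facetTerm_add_eq_zero (hd : 0 < d) (h : IsMeshOf conn x₀ Ω) (x : V → Space d) (i : V)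
    (v : Space d) {a b : Elt × Fin (d + 1)} (hab : b.1 ≠ a.1)
    (hf : facet conn b.1 b.2 = facet conn a.1 a.2) :
    facetTerm conn x₀ x i v a + facetTerm conn x₀ x i v b = 0 := by
  obtain ⟨K, j⟩ := a
  obtain ⟨K', j'⟩ := b
  simp only at hab hf
  by_cases hi : i ∈ facet conn K j
  · rw [facetTerm, if_pos hi, facetTerm, if_pos (hf ▸ hi)]
    obtain ⟨σ, hσ⟩ := exists_perm_of_facet_subset h.conn_injective
      (hf ▸ facet_subset_range K' j' : facet conn K j ⊆ Set.range (conn K'))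
    have hj : σ j = j' := facet_injective h.conn_injective K' ((facet_eq_of_perm hσ).trans hf.symm)
    have h1 := facetForm_comp (elementVertices conn x K') σ j v
    have h2 : facetForm (elementVertices conn x K' ∘ σ) j v =
        facetForm (elementVertices conn x K) j v := by
      refine facetForm_congr (fun k hk => ?_) v
      rw [Function.comp_apply, elementVertices, hσ k hk]
      rfl
    rw [hj, h2] at h1
    rw [h.orientation_eq_neg hd hab.symm hσ, h1]
    have hs : ((Equiv.Perm.sign σ : ℤ) : ℝ) * ((Equiv.Perm.sign σ : ℤ) : ℝ) = 1 := by
      rcases Int.units_eq_one_or (Equiv.Perm.sign σ) with hs | hs <;> rw [hs] <;> simp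
    linear_combination (-(orientation conn x₀ K' * facetForm (elementVertices conn x K') j' v)) * hs
  · rw [facetTerm, if_neg hi, facetTerm, if_neg (hf ▸ hi), add_zero]

/-- At a boundary facet the admissible motions do not change the volume. -/
theorem facetTerm_eq_zero_of_isBoundaryFacet (hd : 0 < d) (h : IsMeshOf conn x₀ Ω)
    {W : V → Submodule ℝ (Space d)} (hW : KeepsBoundary conn x₀ W) {x : V → Space d}
    (hx : ∀ k, x k - x₀ k ∈ W k) {i : V} {v : Space d} (hv : v ∈ W i)
    {a : Elt × Fin (d + 1)} (ha : IsBoundaryFacet conn a.1 a.2) :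
    facetTerm conn x₀ x i v a = 0 := by
  obtain ⟨K, j⟩ := a
  simp only [facetTerm]
  split_ifs with hi
  · set f := (simplexBasis _ (h.nondegenerate K)).coord j with hf
    have hfacet : x₀ '' facet conn K j = elementVertices conn x₀ K '' {j}ᶜ := by
      rw [facet, Set.image_image]
      rfl
    have hzero : ∀ w ∈ (affineSpan ℝ (x₀ '' facet conn K j)).direction, f.linear w = 0 := by
      intro w hw
      obtain ⟨y, hy⟩ : (affineSpan ℝ (x₀ '' facet conn K j) : Set (Space d)).Nonempty :=
        ⟨_, subset_affineSpan ℝ _ ⟨i, hi, rfl⟩⟩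
      have hwy : w +ᵥ y ∈ affineSpan ℝ (x₀ '' facet conn K j) :=
        AffineSubspace.vadd_mem_of_mem_direction hw hy
      have h1 := f.map_vadd y w
      rw [hfacet] at hwy hy
      rw [coord_eq_zero_of_mem_facet (h.nondegenerate K) hwy,
        coord_eq_zero_of_mem_facet (h.nondegenerate K) hy] at h1
      simpa using h1.symm
    have hne : f.linear ≠ 0 := by
      intro h0
      have h1 := f.linearMap_vsub (elementVertices conn x₀ K j) (x₀ i)
      have h2 : f (elementVertices conn x₀ K j) = 1 :=
        (simplexBasis _ (h.nondegenerate K)).coord_apply_eq j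
      have h3 : f (x₀ i) = 0 := coord_eq_zero_of_mem_facet (h.nondegenerate K)
        (subset_affineSpan ℝ _ (hfacet ▸ ⟨i, hi, rfl⟩))
      rw [h0, h2, h3] at h1
      simp at h1
    rw [facetForm_eq_zero hd hne ?_ (hzero v (hW K j ha i hi hv)), mul_zero]
    intro k k' hk hk'
    have hmem : ∀ k, k ≠ j → conn K k ∈ facet conn K j := fun k hk => ⟨k, hk, rfl⟩
    have e1 := hzero _ (hW K j ha _ (hmem k hk) (hx (conn K k)))
    have e2 := hzero _ (hW K j ha _ (hmem k' hk') (hx (conn K k')))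
    have e3 := hzero _ (AffineSubspace.vsub_mem_direction
      (subset_affineSpan ℝ _ ⟨_, hmem k hk, rfl⟩) (subset_affineSpan ℝ _ ⟨_, hmem k' hk', rfl⟩))
    rw [vsub_eq_sub, map_sub] at e3
    rw [map_sub] at e1 e2 ⊢
    simp only [elementVertices]
    linarith
  · rfl

variable [Fintype Elt]

/-- A nonboundary facet belongs to exactly two elements. Exchanging them is an involution without
fixed points under which the terms cancel; boundary facets contribute nothing. -/
theorem sum_facetTerm_eq_zero (hd : 0 < d) (h : IsMeshOf conn x₀ Ω)
    {W : V → Submodule ℝ (Space d)} (hW : KeepsBoundary conn x₀ W) {x : V → Space d}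
    (hx : ∀ k, x k - x₀ k ∈ W k) {i : V} {v : Space d} (hv : v ∈ W i) :
    ∑ a : Elt × Fin (d + 1), facetTerm conn x₀ x i v a = 0 := by
  classical
  have hex : ∀ a : Elt × Fin (d + 1), ¬ IsBoundaryFacet conn a.1 a.2 →
      ∃ b : Elt × Fin (d + 1), b.1 ≠ a.1 ∧ facet conn b.1 b.2 = facet conn a.1 a.2 := by
    intro a ha
    simp only [IsBoundaryFacet, not_forall] at ha
    obtain ⟨K', hK', hne⟩ := ha
    obtain ⟨σ, hσ⟩ := exists_perm_of_facet_subset h.conn_injective hK'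
    exact ⟨(K', σ a.2), hne, facet_eq_of_perm hσ⟩
  have huniq : ∀ a b c : Elt × Fin (d + 1), b.1 ≠ a.1 → c.1 ≠ a.1 →
      facet conn b.1 b.2 = facet conn a.1 a.2 → facet conn c.1 c.2 = facet conn a.1 a.2 →
      b = c := by
    rintro a ⟨b₁, b₂⟩ ⟨c₁, c₂⟩ hb hc hfb hfc
    have h1 : b₁ = c₁ := h.eq_of_facet_subset hd (hfb ▸ facet_subset_range _ _) hb
      (hfc ▸ facet_subset_range _ _) hc
    subst h1
    rw [Prod.mk.injEq]
    exact ⟨rfl, facet_injective h.conn_injective b₁ (hfb.trans hfc.symm)⟩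
  choose g hg1 hg2 using hex
  have hgb : ∀ a ha, ¬ IsBoundaryFacet conn (g a ha).1 (g a ha).2 := fun a ha hb =>
    hg1 a ha (hb a.1 (by rw [hg2]; exact facet_subset_range _ _)).symm
  rw [← Finset.sum_filter_add_sum_filter_not _
    (fun a : Elt × Fin (d + 1) => IsBoundaryFacet conn a.1 a.2),
    Finset.sum_eq_zero fun a ha => facetTerm_eq_zero_of_isBoundaryFacet hd h hW hx hv
      (Finset.mem_filter.1 ha).2, zero_add]
  refine Finset.sum_involution (fun a ha => g a (Finset.mem_filter.1 ha).2) ?_ ?_ ?_ ?_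
  · exact fun a ha => facetTerm_add_eq_zero hd h x i v (hg1 a _) (hg2 a _)
  · intro a ha _ heq
    exact hg1 a (Finset.mem_filter.1 ha).2 (congrArg Prod.fst heq)
  · exact fun a ha => Finset.mem_filter.2 ⟨Finset.mem_univ _, hgb a _⟩
  · intro a ha
    have hna := (Finset.mem_filter.1 ha).2
    exact huniq (g a hna) _ _ (hg1 _ (hgb a hna)) (hg1 a hna).symm (hg2 _ _) (hg2 a hna).symm

/-- `d!` times the total volume, with the orientation of the initial mesh. -/
noncomputable def signedVolume (conn : Elt → Fin (d + 1) → V) (x₀ x : V → Space d) : ℝ :=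
  ∑ K, orientation conn x₀ K * (edgeMatrix (elementVertices conn x K)).det

/-- A vertex changes the determinant of its element by the form of the opposite facet. By
translation invariance this is minus the sum over the facets that contain the vertex, and those are
shared with neighbours. -/
theorem signedVolume_update [DecidableEq V] (hd : 0 < d) (h : IsMeshOf conn x₀ Ω)
    {W : V → Submodule ℝ (Space d)} (hW : KeepsBoundary conn x₀ W) {x : V → Space d}
    (hx : ∀ k, x k - x₀ k ∈ W k) {i : V} {v : Space d} (hv : v ∈ W i) :
    signedVolume conn x₀ (Function.update x i (x i + v)) = signedVolume conn x₀ x := by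
  have hK : ∀ K, orientation conn x₀ K *
      (edgeMatrix (elementVertices conn (Function.update x i (x i + v)) K)).det =
      orientation conn x₀ K * (edgeMatrix (elementVertices conn x K)).det -
        ∑ j, facetTerm conn x₀ x i v (K, j) := by
    intro K
    by_cases hi : i ∈ Set.range (conn K)
    · obtain ⟨j, rfl⟩ := hi
      have h1 : ∑ k, facetTerm conn x₀ x (conn K j) v (K, k) =
          ∑ k ∈ Finset.univ.erase j,
            orientation conn x₀ K * facetForm (elementVertices conn x K) k v := by
        rw [← Finset.add_sum_erase _ _ (Finset.mem_univ j)]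
        have h2 : facetTerm conn x₀ x (conn K j) v (K, j) = 0 := by
          refine if_neg ?_
          rintro ⟨k, hk, hkj⟩
          exact hk (h.conn_injective K hkj)
        rw [h2, zero_add]
        refine Finset.sum_congr rfl fun k hk => if_pos ⟨j, ?_, rfl⟩
        exact (Finset.ne_of_mem_erase hk).symm
      have h3 := sum_facetForm (elementVertices conn x K) v
      rw [← Finset.add_sum_erase _ _ (Finset.mem_univ j)] at h3
      rw [h1, ← Finset.mul_sum, elementVertices_update_of_eq h.conn_injective]
      have h4 := edgeMatrix_det_update_add (elementVertices conn x K) j v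
      change (edgeMatrix (Function.update _ j (x (conn K j) + v))).det = _ at h4
      rw [h4]
      linear_combination orientation conn x₀ K * h3
    · rw [elementVertices_update_of_notMem x hi, Finset.sum_eq_zero, sub_zero]
      intro j _
      exact if_neg fun hm => hi (facet_subset_range K j hm)
  have hsum := sum_facetTerm_eq_zero hd h hW hx hv
  rw [Fintype.sum_prod_type] at hsum
  simp only [signedVolume, hK, Finset.sum_sub_distrib, hsum, sub_zero]

variable [Fintype V]

/-- The vertices are moved one at a time. The intermediate configurations need not be meshes; only
the admissibility of the displacements matters. -/
theorem signedVolume_eq (hd : 0 < d) (h : IsMeshOf conn x₀ Ω)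
    {W : V → Submodule ℝ (Space d)} (hW : KeepsBoundary conn x₀ W) {x : V → Space d}
    (hx : ∀ k, x k - x₀ k ∈ W k) : signedVolume conn x₀ x = signedVolume conn x₀ x₀ := by
  classical
  have hs : ∀ s : Finset V,
      signedVolume conn x₀ (s.piecewise x x₀) = signedVolume conn x₀ x₀ := by
    intro s
    induction s using Finset.induction_on with
    | empty => rw [Finset.piecewise_empty]
    | insert i s hi ih =>
      rw [← ih, Finset.piecewise_insert]
      have h1 : x i = s.piecewise x x₀ i + (x i - x₀ i) := by
        rw [Finset.piecewise_eq_of_notMem _ _ _ hi]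
        abel
      rw [h1]
      refine signedVolume_update hd h hW (fun k => ?_) (hx i)
      by_cases hk : k ∈ s
      · rw [Finset.piecewise_eq_of_mem _ _ _ hk]
        exact hx k
      · rw [Finset.piecewise_eq_of_notMem _ _ _ hk, sub_self]
        exact zero_mem _
  have := hs Finset.univ
  rwa [Finset.piecewise_univ] at this

/-- The total volume of a mesh does not change under admissible motions that keep the orientation
of the elements. -/
theorem sum_simplexVolume_eq (hd : 0 < d) (h : IsMeshOf conn x₀ Ω)
    {W : V → Submodule ℝ (Space d)} (hW : KeepsBoundary conn x₀ W) {x : V → Space d}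
    (hx : ∀ k, x k - x₀ k ∈ W k)
    (hor : ∀ K, 0 < (edgeMatrix (elementVertices conn x₀ K)).det *
      (edgeMatrix (elementVertices conn x K)).det) :
    ∑ K, simplexVolume (elementVertices conn x K) =
      ∑ K, simplexVolume (elementVertices conn x₀ K) := by
  have h1 : ∀ y : V → Space d, (∀ K, 0 < (edgeMatrix (elementVertices conn x₀ K)).det *
      (edgeMatrix (elementVertices conn y K)).det) →
      ∑ K, simplexVolume (elementVertices conn y K) = signedVolume conn x₀ y / d.factorial := by
    intro y hy
    simp only [simplexVolume, signedVolume, Finset.sum_div]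
    refine Finset.sum_congr rfl fun K _ => ?_
    congr 1
    simp only [orientation]
    rcases mul_pos_iff.1 (hy K) with ⟨ha, hb⟩ | ⟨ha, hb⟩
    · rw [sign_pos ha, abs_of_pos hb]; simp
    · rw [sign_neg ha, abs_of_neg hb]; simp
  rw [h1 x hor, h1 x₀ fun K => mul_self_pos.2
    ((affineIndependent_iff_det_ne_zero _).1 (h.nondegenerate K)), signedVolume_eq hd h hW hx]

end MeshCombinatorics

/-! ### Admissible displacement and energy decay -/

section GradientFlow

variable {d : ℕ} {V : Type*} [DecidableEq V] {I : (V → Space d) → ℝ}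
  {nonsingular : (V → Space d) → Prop} {W : V → Submodule ℝ (Space d)} {P : ℝ → V → ℝ}
  {τ : ℝ} {T : EReal} {y : ℝ → V → Space d} {t : ℝ}

theorem IsGradientFlow.continuousOn_Icc (h : IsGradientFlow I nonsingular W P τ T y)
    (htT : (t : EReal) < T) : ContinuousOn y (Set.Icc 0 t) :=
  h.continuousOn.mono fun _ hs => ⟨hs.1, (EReal.coe_le_coe_iff.2 hs.2).trans_lt htT⟩

theorem IsGradientFlow.equation_of_mem_Ioo (h : IsGradientFlow I nonsingular W P τ T y)
    (htT : (t : EReal) < T) (hns : ∀ s ∈ Set.Icc 0 t, nonsingular (y s)) {s : ℝ}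
    (hs : s ∈ Set.Ioo 0 t) (i : V) :
    HasDerivAt (fun s => y s i) (-(P s i / τ) •
      (W i).starProjection (gradient (fun z => I (Function.update (y s) i z)) (y s i))) s :=
  h.equation s hs.1 ((EReal.coe_lt_coe_iff.2 hs.2).trans htT) (hns s ⟨hs.1.le, hs.2.le⟩) i

/-- The vertices only move in the admissible directions. -/
theorem IsGradientFlow.sub_mem (h : IsGradientFlow I nonsingular W P τ T y) (ht : 0 ≤ t)
    (htT : (t : EReal) < T) (hns : ∀ s ∈ Set.Icc 0 t, nonsingular (y s)) (i : V) :
    y t i - y 0 i ∈ W i := by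
  rcases ht.eq_or_lt with rfl | ht
  · rw [sub_self]
    exact zero_mem _
  -- Tested against a vector orthogonal to `W i`, the position has zero derivative.
  rw [← Submodule.orthogonal_orthogonal (W i), Submodule.mem_orthogonal]
  intro w hw
  have hcont : ContinuousOn (fun s => inner ℝ w (y s i)) (Set.Icc 0 t) :=
    continuousOn_const.inner ((continuous_apply i).comp_continuousOn (h.continuousOn_Icc htT))
  obtain ⟨s, hs, hslope⟩ := exists_hasDerivAt_eq_slope (fun s => inner ℝ w (y s i)) (fun _ => 0)
    ht hcont fun s hs => by
      have h1 := (hasDerivAt_const s w).inner ℝ (h.equation_of_mem_Ioo htT hns hs i)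
      refine h1.congr_deriv ?_
      rw [inner_zero_left, add_zero, inner_smul_right, (Submodule.mem_orthogonal' _ _).1 hw _
        (Submodule.starProjection_apply_mem _ _), mul_zero]
  rw [sub_zero, eq_comm, div_eq_zero_iff] at hslope
  rw [inner_sub_right]
  exact hslope.resolve_right ht.ne'

variable [Fintype V]

/-- A variation of the mesh is the sum of variations of single vertices, on which the derivative is
given by the partial gradients. -/
theorem fderiv_eq_sum_inner_gradient {z : V → Space d} (hI : DifferentiableAt ℝ I z)
    (v : V → Space d) :
    fderiv ℝ I z v =
      ∑ i, inner ℝ (gradient (fun w => I (Function.update z i w)) (z i)) (v i) := by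
  have h1 : v = ∑ i, Pi.single i (v i) := (Finset.univ_sum_single v).symm
  conv_lhs => rw [h1, map_sum]
  refine Finset.sum_congr rfl fun i _ => ?_
  have hI' : HasFDerivAt I (fderiv ℝ I z) (Function.update z i (z i)) := by
    rw [Function.update_eq_self]
    exact hI.hasFDerivAt
  have h2 := hI'.comp (z i) (hasFDerivAt_update z (z i))
  have h3 : fderiv ℝ (fun w => I (Function.update z i w)) (z i) = _ := h2.fderiv
  rw [gradient, InnerProductSpace.toDual_symm_apply, h3, ContinuousLinearMap.comp_apply]
  congr 1
  ext1 j
  by_cases hj : j = i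
  · subst hj
    simp
  · simp [hj]

/-- The energy decreases along the flow. -/
theorem IsGradientFlow.energy_le (h : IsGradientFlow I nonsingular W P τ T y) (hτ : 0 < τ)
    (hP : ∀ t : ℝ, 0 < t → (t : EReal) < T → ∀ i, 0 < P t i) (ht : 0 ≤ t)
    (htT : (t : EReal) < T) (hns : ∀ s ∈ Set.Icc 0 t, nonsingular (y s))
    (hI : ∀ s ∈ Set.Icc 0 t, DifferentiableAt ℝ I (y s)) : I (y t) ≤ I (y 0) := by
  rcases ht.eq_or_lt with rfl | ht
  · exact le_rfl
  have hcont : ContinuousOn (fun s => I (y s)) (Set.Icc 0 t) := fun s hs =>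
    (hI s hs).continuousAt.comp_continuousWithinAt (h.continuousOn_Icc htT s hs)
  -- The mean value theorem uses the equation only at interior times and requires no regularity of
  -- `P` in time.
  obtain ⟨s, hs, hslope⟩ := exists_hasDerivAt_eq_slope (fun s => I (y s))
    (fun s => fderiv ℝ I (y s) fun i => (-(P s i / τ) •
      (W i).starProjection (gradient (fun z => I (Function.update (y s) i z)) (y s i))))
    ht hcont fun s hs => (hI s ⟨hs.1.le, hs.2.le⟩).hasFDerivAt.comp_hasDerivAt s
      (hasDerivAt_pi.2 fun i => h.equation_of_mem_Ioo htT hns hs i)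
  have hnonpos : (I (y t) - I (y 0)) / (t - 0) ≤ 0 := by
    rw [← hslope, fderiv_eq_sum_inner_gradient (hI s ⟨hs.1.le, hs.2.le⟩)]
    refine Finset.sum_nonpos fun i _ => ?_
    rw [inner_smul_right]
    refine mul_nonpos_of_nonpos_of_nonneg (neg_nonpos.2 (div_nonneg
      (hP s hs.1 ((EReal.coe_lt_coe_iff.2 hs.2).trans htT) i).le hτ.le)) ?_
    rw [real_inner_comm]
    -- An orthogonal projection is positive semidefinite, so projected descent still decreases the
    -- energy.
    exact Submodule.re_inner_starProjection_nonneg (W i) _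
  rw [sub_zero, div_nonpos_iff] at hnonpos
  rcases hnonpos with ⟨_, h2⟩ | ⟨h1, _⟩
  · linarith
  · linarith

end GradientFlow

/-! ### The continuation argument -/

section Barrier

/-- Continuous functions with a lower bound that holds as long as they are positive stay
positive. -/
theorem pos_of_barrier {ι : Type*} [Finite ι] {f : ι → ℝ → ℝ} {t : ℝ}
    (hc : ∀ i, ContinuousOn (f i) (Set.Icc 0 t)) (h0 : ∀ i, 0 < f i 0) {δ : ι → ℝ}
    (hδ : ∀ i, 0 < δ i)
    (h : ∀ s ∈ Set.Icc 0 t, (∀ u ∈ Set.Icc 0 s, ∀ i, 0 < f i u) → ∀ i, δ i ≤ f i s) :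
    ∀ s ∈ Set.Icc 0 t, ∀ i, 0 < f i s := by
  by_contra hcon
  push Not at hcon
  obtain ⟨s₀, hs₀, i₀, hi₀⟩ := hcon
  -- The times at which some function fails to be positive form a compact set. Before the least of
  -- them the bound `δ i` holds, and it passes to the limit.
  set B : Set ℝ := ⋃ i, Set.Icc 0 t ∩ f i ⁻¹' Set.Iic 0 with hB
  have hBc : IsCompact B := isCompact_iUnion fun i =>
    isCompact_Icc.of_isClosed_subset ((hc i).preimage_isClosed_of_isClosed isClosed_Icc isClosed_Iic)
      Set.inter_subset_left
  obtain ⟨s, hsB, hmin⟩ := hBc.exists_isLeast ⟨s₀, Set.mem_iUnion.2 ⟨i₀, hs₀, hi₀⟩⟩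
  obtain ⟨i, hs, hi⟩ := Set.mem_iUnion.1 hsB
  have hs0 : 0 < s := by
    refine lt_of_le_of_ne hs.1 ?_
    rintro rfl
    exact absurd (h0 i) (not_lt.2 hi)
  have hpos : ∀ u ∈ Set.Ico 0 s, ∀ j, 0 < f j u := by
    intro u hu j
    by_contra hj
    exact absurd (hmin (Set.mem_iUnion.2 ⟨j, ⟨hu.1, hu.2.le.trans hs.2⟩, not_lt.1 hj⟩))
      (not_le.2 hu.2)
  have hge : ∀ u ∈ Set.Ico 0 s, δ i ≤ f i u := fun u hu =>
    h u ⟨hu.1, hu.2.le.trans hs.2⟩ (fun w hw => hpos w ⟨hw.1, hw.2.trans_lt hu.2⟩) i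
  have hne : (nhdsWithin s (Set.Ico 0 s)).NeBot := by
    rw [← mem_closure_iff_nhdsWithin_neBot, closure_Ico hs0.ne]
    exact ⟨hs0.le, le_rfl⟩
  have hlim : Filter.Tendsto (f i) (nhdsWithin s (Set.Ico 0 s)) (nhds (f i s)) :=
    ((hc i) s hs).mono fun u hu => ⟨hu.1, hu.2.le.trans hs.2⟩
  have := ge_of_tendsto hlim (eventually_mem_nhdsWithin.mono hge)
  exact absurd (lt_of_lt_of_le (hδ i) this) (not_lt.2 hi)

end Barrier

/-! ### Application to meshes -/

section MeshFlows

variable {d : ℕ} {V Elt : Type*} {conn : Elt → Fin (d + 1) → V}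

theorem continuous_edgeMatrix_det [Fintype V] (conn : Elt → Fin (d + 1) → V) (K : Elt) :
    Continuous fun y : V → Space d => (edgeMatrix (elementVertices conn y K)).det :=
  continuous_iff_continuousAt.2 fun _ =>
    (entrywiseDifferentiableAt_edgeMatrix conn differentiableAt_fun_id K).det.continuousAt

variable [Fintype Elt] [Nonempty Elt] {γ θ m₀ m₁ α β vol E₀ : ℝ} {M : Space d → Matrix (Fin d) (Fin d) ℝ}
  {x ξ : V → Space d}

theorem lowerBounds_of_trace_rpow_le (hd : 0 < d) (hγ : 1 < γ) (hm₀ : 0 < m₀) (hα : 0 < α)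
    (hM : ∀ K, MetricBounds m₀ m₁ (elementMetric M conn x K)) (hns : Nonsingular conn x ξ)
    (h : ∀ K, α * (simplexVolume (elementVertices conn x K) *
      (pullback (jacobian conn x ξ K) (elementMetric M conn x K)).trace ^ ((d : ℝ) * γ / 2)) ≤
      β * vol + E₀)
    {pHat : Fin (d + 1) → Space d} (hpHat : AffineIndependent ℝ pHat) {r₀ : ℝ} (hr₀ : 0 < r₀)
    (hr : InDiameterBound conn ξ r₀) :
    LowerBounds γ M conn x
      (constC₁ d γ α β (minHeight 1 pHat) (Metric.diam (simplex pHat)) vol E₀)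
      (constC₂ d γ α β (minHeight 1 pHat) (Metric.diam (simplex pHat)) vol E₀) r₀ m₁ := by
  intro K
  have hN : (0 : ℝ) < Fintype.card Elt := by exact_mod_cast Fintype.card_pos
  exact element_bounds hd hγ hm₀ hα hr₀ hN (minHeight_nonneg _ _) (diam_simplex_pos hd hpHat)
    (minHeight_one_le_diam hd pHat) (hns.det_ne_zero K).1 (hns.det_ne_zero K).2 (hM K) (h K)
    (hr K) rfl

end MeshFlows

/-! ### Nonsingularity along the two flows -/

section MeshFlowBounds

variable {d : ℕ} {V Elt : Type*} [Fintype V] [DecidableEq V] [Fintype Elt]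
  {conn : Elt → Fin (d + 1) → V} {Ωp : Set (Space d)} {x₀ ξ₀ : V → Space d}
  {γ θ m₀ m₁ α β τ t : ℝ} {M : Space d → Matrix (Fin d) (Fin d) ℝ} {P : ℝ → V → ℝ}
  {W : V → Submodule ℝ (Space d)} {T : EReal}

/-- As long as the physical mesh is nonsingular, its total volume is that of the initial mesh and
the energy bounds the traces of the pulled back metrics. -/
theorem trace_rpow_le_of_physical_flow (hd : 0 < d) (hm₀ : 0 < m₀) (hτ : 0 < τ) (hα : 0 < α)
    (hβ : 0 ≤ β) (hx₀ : IsMeshOf conn x₀ Ωp)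
    (hM : ∀ z ∈ closure Ωp, MetricBounds m₀ m₁ (M z))
    (hMdiff : ∀ z ∈ closure Ωp, ∀ a b, DifferentiableAt ℝ (fun y => M y a b) z)
    (hco : IsCoercive d γ θ m₀ m₁ α β)
    (hP : ∀ t : ℝ, 0 < t → (t : EReal) < T → ∀ i, 0 < P t i) (hW : KeepsBoundary conn x₀ W)
    {x : ℝ → V → Space d} (hx : x 0 = x₀)
    (hflow : IsGradientFlow (fun y => discreteEnergy γ θ M conn y ξ₀)
      (fun y => Nonsingular conn y ξ₀) W P τ T x)
    (hmem : ∀ t : ℝ, 0 ≤ t → (t : EReal) < T → ∀ i, x t i ∈ closure Ωp)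
    (ht : 0 ≤ t) (htT : (t : EReal) < T) (hns : ∀ s ∈ Set.Icc 0 t, Nonsingular conn (x s) ξ₀)
    (K : Elt) :
    α * (simplexVolume (elementVertices conn (x t) K) *
      (pullback (jacobian conn (x t) ξ₀ K) (elementMetric M conn (x t) K)).trace ^
        ((d : ℝ) * γ / 2)) ≤
      β * volume.real Ωp + discreteEnergy γ θ M conn x₀ ξ₀ := by
  have hmem' : ∀ s ∈ Set.Icc 0 t, ∀ i, x s i ∈ closure Ωp := fun s hs =>
    hmem s hs.1 ((EReal.coe_le_coe_iff.2 hs.2).trans_lt htT)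
  have hMK : ∀ s ∈ Set.Icc 0 t, ∀ K, MetricBounds m₀ m₁ (elementMetric M conn (x s) K) :=
    fun s hs K => MetricBounds.elementMetric fun j => hM _ (hmem' s hs _)
  have henergy := hflow.energy_le hτ hP ht htT hns fun s hs =>
    differentiableAt_discreteEnergy hd conn differentiableAt_fun_id (differentiableAt_const _)
      (fun K j => hMdiff _ (hmem' s hs (conn K j))) (fun K => (hMK s hs K).posDef hm₀) (hns s hs)
  have hvol : ∑ K, simplexVolume (elementVertices conn (x t) K) ≤ volume.real Ωp := by
    refine (sum_simplexVolume_eq hd hx₀ hW ?_ fun K => ?_).trans_le hx₀.sum_simplexVolume_le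
    · intro i
      rw [← hx]
      exact hflow.sub_mem ht htT hns i
    · have h1 := (nonsingular_iff _ _ _).1 (hns 0 ⟨le_rfl, ht⟩) K
      have h2 := (nonsingular_iff _ _ _).1 (hns t ⟨ht, le_rfl⟩) K
      rw [hx] at h1
      -- The product of the two conditions contains the square of the fixed computational
      -- determinant, so the physical orientation is that of the initial mesh.
      have h3 := mul_pos h1 h2
      have h4 := (hns t ⟨ht, le_rfl⟩).det_ne_zero K
      rw [mul_mul_mul_comm] at h3
      exact pos_of_mul_pos_left h3 (mul_self_nonneg _)
  rw [hx] at henergy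
  exact trace_rpow_le_energy hd hm₀ hα hβ hco (hMK t ⟨ht, le_rfl⟩) (hns t ⟨ht, le_rfl⟩) hvol
    henergy K

/-- The trace bound holds on any interval without degeneration and gives a time-independent lower
bound for the physical determinants there; the barrier argument then covers all of `[0, t]`. -/
theorem nonsingular_of_physical_flow (hd : 0 < d) (hγ : 1 < γ) (hm₀ : 0 < m₀) (hτ : 0 < τ)
    (hα : 0 < α) (hβ : 0 ≤ β) (hx₀ : IsMeshOf conn x₀ Ωp)
    (hM : ∀ z ∈ closure Ωp, MetricBounds m₀ m₁ (M z))
    (hMdiff : ∀ z ∈ closure Ωp, ∀ a b, DifferentiableAt ℝ (fun y => M y a b) z)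
    (hco : IsCoercive d γ θ m₀ m₁ α β) (hns₀ : Nonsingular conn x₀ ξ₀)
    (hP : ∀ t : ℝ, 0 < t → (t : EReal) < T → ∀ i, 0 < P t i) (hW : KeepsBoundary conn x₀ W)
    {x : ℝ → V → Space d} (hx : x 0 = x₀)
    (hflow : IsGradientFlow (fun y => discreteEnergy γ θ M conn y ξ₀)
      (fun y => Nonsingular conn y ξ₀) W P τ T x)
    (hmem : ∀ t : ℝ, 0 ≤ t → (t : EReal) < T → ∀ i, x t i ∈ closure Ωp)
    (ht : 0 ≤ t) (htT : (t : EReal) < T) :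
    ∀ s ∈ Set.Icc 0 t, Nonsingular conn (x s) ξ₀ := by
  have : Nonempty (Fin d) := ⟨⟨0, hd⟩⟩
  have hbound : ∀ s ∈ Set.Icc 0 t, (∀ u ∈ Set.Icc 0 s, Nonsingular conn (x u) ξ₀) → ∀ K, _ :=
    fun s hs hns => trace_rpow_le_of_physical_flow hd hm₀ hτ hα hβ hx₀ hM hMdiff hco hP hW hx
      hflow hmem hs.1 ((EReal.coe_le_coe_iff.2 hs.2).trans_lt htT) hns
  set B := β * volume.real Ωp + discreteEnergy γ θ M conn x₀ ξ₀ with hB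
  have hMK : ∀ s ∈ Set.Icc 0 t, ∀ K, MetricBounds m₀ m₁ (elementMetric M conn (x s) K) :=
    fun s hs K => MetricBounds.elementMetric fun j =>
      hM _ (hmem s hs.1 ((EReal.coe_le_coe_iff.2 hs.2).trans_lt htT) _)
  have hBpos : Elt → 0 < B := by
    intro K
    have h0 : (0 : ℝ) ∈ Set.Icc 0 t := ⟨le_rfl, ht⟩
    have h1 := hbound 0 h0 (fun u hu => by
      rw [le_antisymm hu.2 hu.1, hx]
      exact hns₀) K
    have h2 := (pullback_posDef (hns₀ K).ne' ((hx ▸ hMK 0 h0 K).posDef hm₀)).trace_pos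
    have h3 := simplexVolume_pos (hns₀.det_ne_zero K).1
    rw [hx] at h1
    exact lt_of_lt_of_le (by positivity) h1
  have hm₁ : Elt → 0 < m₁ := fun K => hm₀.trans_le ((hMK 0 ⟨le_rfl, ht⟩ K).le hd)
  have hpos := pos_of_barrier
    (f := fun K s => (edgeMatrix (elementVertices conn (x s) K)).det *
      (edgeMatrix (elementVertices conn ξ₀ K)).det) (t := t)
    -- The estimate of `det_rpow_le_of_trace_rpow_le` solved for the physical determinant, times the
    -- constant computational one.
    (δ := fun K => (α / d.factorial * (|(edgeMatrix (elementVertices conn ξ₀ K)).det| ^ γ *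
      ((m₁ ^ d) ^ (γ / 2))⁻¹) / B) ^ (γ - 1)⁻¹ * |(edgeMatrix (elementVertices conn ξ₀ K)).det|)
    (fun K => ((continuous_edgeMatrix_det conn K).comp_continuousOn
      (hflow.continuousOn_Icc htT)).mul continuousOn_const)
    (fun K => by
      rw [hx]
      exact (nonsingular_iff _ _ _).1 hns₀ K)
    (fun K => by
      have h1 := abs_pos.2 (hns₀.det_ne_zero K).2
      have h2 := hBpos K
      have h3 := hm₁ K
      positivity)
    (fun s hs hu K => by
      have hns : ∀ u ∈ Set.Icc 0 s, Nonsingular conn (x u) ξ₀ := fun u hu' =>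
        (nonsingular_iff _ _ _).2 (hu u hu')
      have hnss := (hns s ⟨hs.1, le_rfl⟩).det_ne_zero K
      have h1 := det_rpow_le_of_trace_rpow_le hd hγ hm₀ hα hnss.1 hnss.2 (hMK s hs K)
        (hbound s hs hns K)
      have h2 := hBpos K
      have h3 := hm₁ K
      rw [← abs_of_pos (hu s ⟨hs.1, le_rfl⟩ K), abs_mul]
      refine mul_le_mul_of_nonneg_right ?_ (abs_nonneg _)
      rw [Real.rpow_inv_le_iff_of_pos (by positivity) (abs_nonneg _) (by linarith),
        div_le_iff₀' h2]
      exact h1)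
  exact fun s hs => (nonsingular_iff _ _ _).2 (hpos s hs)

theorem energy_le_of_computational_flow (hd : 0 < d) (hτ : 0 < τ)
    (hM : ∀ K, (elementMetric M conn x₀ K).PosDef)
    (hMdiff : ∀ K j a b, DifferentiableAt ℝ (fun y => M y a b) (x₀ (conn K j)))
    (hP : ∀ t : ℝ, 0 < t → (t : EReal) < T → ∀ i, 0 < P t i)
    {ξ : ℝ → V → Space d} (hξ : ξ 0 = ξ₀)
    (hflow : IsGradientFlow (fun η => discreteEnergy γ θ M conn x₀ η)
      (fun η => Nonsingular conn x₀ η) W P τ T ξ)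
    (ht : 0 ≤ t) (htT : (t : EReal) < T) (hns : ∀ s ∈ Set.Icc 0 t, Nonsingular conn x₀ (ξ s)) :
    discreteEnergy γ θ M conn x₀ (ξ t) ≤ discreteEnergy γ θ M conn x₀ ξ₀ := by
  have h := hflow.energy_le hτ hP ht htT hns fun s hs =>
    differentiableAt_discreteEnergy hd conn (differentiableAt_const _) differentiableAt_fun_id
      hMdiff hM (hns s hs)
  rwa [hξ] at h

/-- When computational elements collapse the trace of `A` need not blow up, so the barrier comes
from the logarithm. The volumes and metrics of the physical elements are constants here. -/
theorem nonsingular_of_computational_flow (hd : 0 < d) (hγ : 1 < γ) (hθ : 0 < θ) (hm₀ : 0 < m₀)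
    (hτ : 0 < τ) (hα : 0 < α) (hβ : 0 ≤ β) (hx₀ : IsMeshOf conn x₀ Ωp)
    (hM : ∀ K, MetricBounds m₀ m₁ (elementMetric M conn x₀ K))
    (hMdiff : ∀ K j a b, DifferentiableAt ℝ (fun y => M y a b) (x₀ (conn K j)))
    (hco : IsCoercive d γ θ m₀ m₁ α β) (hns₀ : Nonsingular conn x₀ ξ₀)
    (hP : ∀ t : ℝ, 0 < t → (t : EReal) < T → ∀ i, 0 < P t i)
    {ξ : ℝ → V → Space d} (hξ : ξ 0 = ξ₀)
    (hflow : IsGradientFlow (fun η => discreteEnergy γ θ M conn x₀ η)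
      (fun η => Nonsingular conn x₀ η) W P τ T ξ)
    (htT : (t : EReal) < T) :
    ∀ s ∈ Set.Icc 0 t, Nonsingular conn x₀ (ξ s) := by
  have hMpos := fun K => (hM K).posDef hm₀
  set B := β * volume.real Ωp + discreteEnergy γ θ M conn x₀ ξ₀ with hB
  have hle := fun K s (hs : s ∈ Set.Icc 0 t)
      (hns : ∀ u ∈ Set.Icc 0 s, Nonsingular conn x₀ (ξ u)) =>
    exp_le_det_sq_of_integrand_le (B := B) hd hγ hθ ((hns s ⟨hs.1, le_rfl⟩).det_ne_zero K).1
      ((hns s ⟨hs.1, le_rfl⟩).det_ne_zero K).2 (hMpos K)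
      (integrand_term_le_energy hd hm₀ hα hβ hco hM (hns s ⟨hs.1, le_rfl⟩)
        hx₀.sum_simplexVolume_le
        (energy_le_of_computational_flow hd hτ hMpos hMdiff hP hξ hflow hs.1
          ((EReal.coe_le_coe_iff.2 hs.2).trans_lt htT) hns) K)
  have hex : ∀ K, ∃ R : ℝ, 0 < R ∧
      ∀ s ∈ Set.Icc 0 t, (∀ u ∈ Set.Icc 0 s, Nonsingular conn x₀ (ξ u)) →
        R ≤ (edgeMatrix (elementVertices conn (ξ s) K)).det ^ 2 := by
    -- The exponential bound involves only the fixed physical mesh and the initial energy, hence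
    -- serves for all times.
    refine fun K => ⟨_, ?_, hle K⟩
    have h1 := (hns₀.det_ne_zero K).1
    have h2 := (hMpos K).det_pos
    positivity
  choose R hR using hex
  have hpos := pos_of_barrier
    (f := fun K s => (edgeMatrix (elementVertices conn x₀ K)).det *
      (edgeMatrix (elementVertices conn (ξ s) K)).det) (t := t)
    (δ := fun K => |(edgeMatrix (elementVertices conn x₀ K)).det| * Real.sqrt (R K))
    (fun K => continuousOn_const.mul ((continuous_edgeMatrix_det conn K).comp_continuousOn
      (hflow.continuousOn_Icc htT)))
    (fun K => by
      rw [hξ]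
      exact (nonsingular_iff _ _ _).1 hns₀ K)
    (fun K => mul_pos (abs_pos.2 (hns₀.det_ne_zero K).1) (Real.sqrt_pos.2 (hR K).1))
    (fun s hs hu K => by
      have hns : ∀ u ∈ Set.Icc 0 s, Nonsingular conn x₀ (ξ u) := fun u hu' =>
        (nonsingular_iff _ _ _).2 (hu u hu')
      rw [← abs_of_pos (hu s ⟨hs.1, le_rfl⟩ K), abs_mul]
      refine mul_le_mul_of_nonneg_left ?_ (abs_nonneg _)
      rw [← Real.sqrt_sq_eq_abs]
      exact Real.sqrt_le_sqrt ((hR K).2 s hs hns))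
  exact fun s hs => (nonsingular_iff _ _ _).2 (hpos s hs)

end MeshFlowBounds

end MovingMesh

/-! ### The theorem for both flows -/

theorem corollary3p1 {d : ℕ} (hd : 1 < d) {γ : ℝ} (hγ : 1 < γ)
    {V Elt : Type*} [Fintype V] [DecidableEq V] [Fintype Elt] [Nonempty Elt]
    (conn : Elt → Fin (d + 1) → V)
    (Ωp Ωc : Set (MovingMesh.Space d)) (hΩp : IsOpen Ωp) (hΩc : IsOpen Ωc)
    (M : MovingMesh.Space d → Matrix (Fin d) (Fin d) ℝ) {m₀ m₁ : ℝ} (hm₀ : 0 < m₀)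
    (hM : ∀ z ∈ Ωp, MovingMesh.MetricBounds m₀ m₁ (M z))
    (hMdiff : ∀ z ∈ closure Ωp, ∀ a b, DifferentiableAt ℝ (fun y => M y a b) z)
    (x₀ ξ₀ : V → MovingMesh.Space d)
    (hx₀ : MovingMesh.IsMeshOf conn x₀ Ωp) (hξ₀ : MovingMesh.IsMeshOf conn ξ₀ Ωc)
    (hns : MovingMesh.Nonsingular conn x₀ ξ₀)
    {τ : ℝ} (hτ : 0 < τ) :
    -- coercivity constants exist, and for all such constants the assertions below hold
    (∃ α β : ℝ, 0 < α ∧ 0 ≤ β ∧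
      MovingMesh.IsCoercive d γ (MovingMesh.theta M Ωp Ωc) m₀ m₁ α β) ∧
    ∀ α β : ℝ, 0 < α → 0 ≤ β →
      MovingMesh.IsCoercive d γ (MovingMesh.theta M Ωp Ωc) m₀ m₁ α β →
    -- the vertices of the reference simplex
    ∀ pHat : Fin (d + 1) → MovingMesh.Space d, AffineIndependent ℝ pHat →
    ∀ C₁ C₂ : ℝ,
      C₁ = MovingMesh.constC₁ d γ α β (MovingMesh.minHeight 1 pHat)
        (Metric.diam (MovingMesh.simplex pHat)) (volume.real Ωp)
        (MovingMesh.discreteEnergy γ (MovingMesh.theta M Ωp Ωc) M conn x₀ ξ₀) →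
      C₂ = MovingMesh.constC₂ d γ α β (MovingMesh.minHeight 1 pHat)
        (Metric.diam (MovingMesh.simplex pHat)) (volume.real Ωp)
        (MovingMesh.discreteEnergy γ (MovingMesh.theta M Ωp Ωc) M conn x₀ ξ₀) →
    ∀ (T : EReal) (P : ℝ → V → ℝ),
      (∀ t : ℝ, 0 < t → (t : EReal) < T → ∀ i, 0 < P t i) →
    ∀ W : V → Submodule ℝ (MovingMesh.Space d),
      -- the flow of the physical vertices, for a fixed computational mesh
      (MovingMesh.KeepsBoundary conn x₀ W →
        ∀ x : ℝ → V → MovingMesh.Space d, x 0 = x₀ →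
          MovingMesh.IsGradientFlow
            (fun y => MovingMesh.discreteEnergy γ (MovingMesh.theta M Ωp Ωc) M conn y ξ₀)
            (fun y => MovingMesh.Nonsingular conn y ξ₀) W P τ T x →
          (∀ t : ℝ, 0 ≤ t → (t : EReal) < T → ∀ i, x t i ∈ closure Ωp) →
          ∀ t : ℝ, 0 ≤ t → (t : EReal) < T →
            MovingMesh.Nonsingular conn (x t) ξ₀ ∧
            (∀ K, 0 < MovingMesh.simplexVolume (MovingMesh.elementVertices conn (x t) K)) ∧
            ∀ r₀ : ℝ, 0 < r₀ → MovingMesh.InDiameterBound conn ξ₀ r₀ →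
              MovingMesh.LowerBounds γ M conn (x t) C₁ C₂ r₀ m₁) ∧
      -- the flow of the computational vertices, for a fixed physical mesh
      (∀ ξ : ℝ → V → MovingMesh.Space d, ξ 0 = ξ₀ →
          MovingMesh.IsGradientFlow
            (fun η => MovingMesh.discreteEnergy γ (MovingMesh.theta M Ωp Ωc) M conn x₀ η)
            (fun η => MovingMesh.Nonsingular conn x₀ η) W P τ T ξ →
          ∀ t : ℝ, 0 ≤ t → (t : EReal) < T →
            MovingMesh.Nonsingular conn x₀ (ξ t) ∧
            (∀ K, 0 < MovingMesh.simplexVolume (MovingMesh.elementVertices conn (ξ t) K)) ∧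
            ∀ r₀ : ℝ, 0 < r₀ → MovingMesh.InDiameterBound conn (ξ t) r₀ →
              MovingMesh.LowerBounds γ M conn x₀ C₁ C₂ r₀ m₁) := by
  have hd0 : 0 < d := by omega
  have hMcl : ∀ z ∈ closure Ωp, MovingMesh.MetricBounds m₀ m₁ (M z) := fun z hz =>
    MovingMesh.metricBounds_of_mem_closure hM
      (fun z hz a b => (hMdiff z hz a b).continuousAt) hz
  refine ⟨MovingMesh.exists_isCoercive hd0 hγ (MovingMesh.theta_nonneg M Ωp Ωc) hm₀, ?_⟩
  rintro α β hα hβ hco pHat hpHat C₁ C₂ rfl rfl T P hP W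
  have hθ := MovingMesh.theta_pos hΩp hΩc hx₀.nonempty hξ₀.nonempty hx₀.isCompact_closure
    hξ₀.isCompact_closure (fun z hz => (hM z hz).posDef hm₀) hMdiff
  refine ⟨fun hW x hx hflow hmem t ht htT => ?_, fun ξ hξ hflow t ht htT => ?_⟩
  · have hnst := MovingMesh.nonsingular_of_physical_flow hd0 hγ hm₀ hτ hα hβ hx₀ hMcl hMdiff hco
      hns hP hW hx hflow hmem ht htT
    have hnt := hnst t ⟨ht, le_rfl⟩
    refine ⟨hnt, fun K => MovingMesh.simplexVolume_pos (hnt.det_ne_zero K).1, fun r₀ hr₀ hr => ?_⟩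
    exact MovingMesh.lowerBounds_of_trace_rpow_le hd0 hγ hm₀ hα
      (fun K => MovingMesh.MetricBounds.elementMetric fun j => hMcl _ (hmem t ht htT _)) hnt
      (MovingMesh.trace_rpow_le_of_physical_flow hd0 hm₀ hτ hα hβ hx₀ hMcl hMdiff hco hP hW hx
        hflow hmem ht htT hnst) hpHat hr₀ hr
  · have hMK : ∀ K, MovingMesh.MetricBounds m₀ m₁ (MovingMesh.elementMetric M conn x₀ K) :=
      fun K => MovingMesh.MetricBounds.elementMetric fun j => hMcl _ (hx₀.vertex_mem_closure K j)
    have hMd : ∀ K j a b, DifferentiableAt ℝ (fun y => M y a b) (x₀ (conn K j)) :=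
      fun K j => hMdiff _ (hx₀.vertex_mem_closure K j)
    have hnst := MovingMesh.nonsingular_of_computational_flow hd0 hγ hθ hm₀ hτ hα hβ hx₀ hMK hMd
      hco hns hP hξ hflow htT
    have hnt := hnst t ⟨ht, le_rfl⟩
    refine ⟨hnt, fun K => MovingMesh.simplexVolume_pos (hnt.det_ne_zero K).2, fun r₀ hr₀ hr => ?_⟩
    exact MovingMesh.lowerBounds_of_trace_rpow_le hd0 hγ hm₀ hα hMK hnt
      (MovingMesh.trace_rpow_le_energy hd0 hm₀ hα hβ hco hMK hnt hx₀.sum_simplexVolume_le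
        (MovingMesh.energy_le_of_computational_flow hd0 hτ (fun K => (hMK K).posDef hm₀) hMd hP
          hξ hflow ht htT hnst)) hpHat hr₀ hr
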